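/- **Setting.** Let $V$ be a finite set, let $f:2^V\to\mathbb R_{\ge 0}$ be monotone, submodular and normalized ($f(\emptyset)=0$), and let $\mathcal M$ be a matroid on $V$ of rank $k$. Write $f(x\mid T)=f(T\cup\{x\})-f(T)$, $\Delta=\max_{x\in V}f(\{x\})\,/\,\min\{f(x\mid T): T\subseteq V,\ x\in V,\ f(x\mid T)\neq 0\}$ (with $\Delta=0$ if there is no nonzero marginal gain), and $\overline{\log}\,x=\log_2\max(x,2)$. A stream is a finite sequence of operations, each inserting an element that is currently not available or deleting one that is; initially nothing is available. $V_i$ is the set of elements available after the $i$-th operation. The function and the matroid are accessed by a value oracle ($T\mapsto f(T)$) and an independence oracle ($T\mapsto$ whether $T\in\mathcal M$); the running time is the total number of calls to the two oracles. **Algorithm for a parameter $n=2^L$.** For each level $\ell=0,\dots,L$ it stores a candidate set $A_\ell$, a buffer $B_\ell$, a solution $S_\ell$ (sorted by decreasing weight, each element $y$ stored with the weight $w(y)$ it had when it was added) and a set $S'_\ell$, all initially empty. At the fictitious level $-1$, $B_{-1}$ is the set of all currently available elements and $A_{-1}=S_{-1}=S'_{-1}=\emptyset$. * *Insert $e$:*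 add $e$ to all $B_\ell$; call LevelConstruct$(\ell^\star)$ for the smallest $\ell^\star$ with $|B_{\ell^\star}|\ge n/2^{\ell^\star}$. * *Delete $e$:* remove $e$ from all $A_\ell$ and $B_\ell$; if $e$ lies in some $S_\ell$, call LevelConstruct$(\ell)$ for the smallest such $\ell$. * *LevelConstruct$(\ell)$:* set $A_\ell= A_{\ell-1}\cup B_{\ell-1}$, $B_\ell=\emptyset$, $S_\ell= S_{\ell-1}$, $S'_\ell= S'_{\ell-1}$. Repeat until $|A_\ell|<n/2^\ell$: for each $e\in A_\ell$ compute $w(e)=f(e\mid S'_\ell)$ and, if $S_\ell+e\notin\mathcal M$, an element $s_e$ of least weight among the $y\in S_\ell$ with $S_\ell-y+e\in\mathcal M$ (found by binary search over the sorted list $S_\ell$; if there is no such $y$, then $e$ is discarded); keep in $A_\ell$ only the $e$ with $S_\ell+e\in\mathcal M$ or $w(e)>2w(s_e)$; if still $|A_\ell|\ge n/2^\ell$, remove a uniformly random $e$ from $A_\ell$, replace $S_\ell$ by $S_\ell+e$ or by $S_\ell-s_e+e$, respectively, and add $e$ to $S'_\ell$. After that, if $\ell<L$, call LevelConstruct$(\ell+1)$.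 **Unknown length.** The dynamic algorithm starts with $n=1$. Whenever the number of operations processed so far reaches $n$, it doubles $n$, re-initializes the data structure, and inserts the available elements one by one. Its solution $S^i$ after operation $i$ is the set $S_L$ at that time. **Theorem.** There is an absolute constant $C>0$ such that, for all $V$, $f$, $\mathcal M$, $k$ as above and every stream of $n$ operations, fixed independently of the algorithm's random choices (oblivious adversary): 1. for every $i\le n$ and every outcome of the random choices, $S^i\subseteq V_i$, $S^i\in\mathcal M$, and $f(T)\le 4f(S^i)$ for every $T\subseteq V_i$ with $T\in\mathcal M$; 2. if $k\ge 1$, then the expected total number of oracle calls made while processing the stream is at most $n\cdot C\,k^2\,\overline{\log}\,k\,\cdot\overline{\log}^2\Delta\cdot\overline{\log}^2 n$; that is, the expected amortized number of oracle calls per operation is $O(k^2\log k\log^2\Delta\log^2 n)$. -/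

import Mathlib

namespace DynSubmod

open scoped ENNReal

universe u v w

/-! ### Set functions -/

section SetFunctions

variable {V : Type u} [DecidableEq V]

/-- The marginal gain `f(x | T) = f(T ∪ {x}) - f(T)` of an element. -/
def marginal (f : Finset V → ℝ) (x : V) (T : Finset V) : ℝ :=
  f (insert x T) - f T

/-- Submodularity: marginal gains of elements do not increase when the set grows. -/
def IsSubmodular (f : Finset V → ℝ) : Prop :=
  ∀ X Y : Finset V, X ⊆ Y → ∀ e : V, e ∉ Y → marginal f e Y ≤ marginal f e X

/-- The parameter `Δ`: the largest value of a singleton, divided by the smallest nonzero marginal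
gain of an element.  On a finite `V` the supremum and the infimum are a maximum and a minimum
(unless `V` is empty or all marginal gains vanish; then this quotient is `0`). -/
noncomputable def spread (f : Finset V → ℝ) : ℝ :=
  (⨆ x : V, f {x}) / sInf {r : ℝ | ∃ (T : Finset V) (x : V), marginal f x T ≠ 0 ∧ r = marginal f x T}

end SetFunctions

/-- The logarithm in base two, with its argument cut off below at `2` (so that it is at least `1`;
it is the ordinary logarithm for arguments `x ≥ 2`). -/
noncomputable def logCut (x : ℝ) : ℝ := Real.logb 2 (max 2 x)

/-! ### Randomized programs with access to a value oracle and an independence oracle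

A program knows nothing about the function `f` and the matroid but the answers to its queries. -/

/-- A randomized oracle program on the ground set `V` with result in `β`: it returns a result, or
asks for the value `f(T)` of a set, or asks whether a set is independent, or draws an element of a
nonempty finite set uniformly at random, and continues according to the answer. -/
inductive OracleProg (V : Type u) (β : Type v) : Type (max u v)
  | ret (b : β) : OracleProg V β
  | value (T : Finset V) (next : ℝ → OracleProg V β) : OracleProg V β
  | indep (T : Finset V) (next : Bool → OracleProg V β) : OracleProg V β
  | sample (A : Finset V) (hA : A.Nonempty) (next : A → OracleProg V β) : OracleProg V β

namespace OracleProg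

variable {V : Type u} {β : Type v} {γ : Type w}

/-- Sequential composition. -/
def bind : OracleProg V β → (β → OracleProg V γ) → OracleProg V γ
  | ret b, g => g b
  | value T next, g => value T fun r => (next r).bind g
  | indep T next, g => indep T fun b => (next b).bind g
  | sample A hA next, g => sample A hA fun a => (next a).bind g

open Classical in
/-- The joint distribution of the result of a program and of the number of oracle calls (value
queries and independence queries, one unit each) that it makes, on the function `f` and the
matroid `M`. -/
noncomputable def run (f : Finset V → ℝ) (M : Matroid V) : OracleProg V β → PMF (β × ℕ)
  | ret b => PMF.pure (b, 0)
  | value T next => ((next (f T)).run f M).map fun r => (r.1, r.2 + 1)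
  | indep T next => ((next (decide (M.Indep (T : Set V)))).run f M).map fun r => (r.1, r.2 + 1)
  | sample A hA next =>
      haveI : Nonempty A := hA.to_subtype
      (PMF.uniformOfFintype A).bind fun a => (next a).run f M

end OracleProg

/-- The expected number of oracle calls of a distribution of pairs (result, number of calls). -/
noncomputable def expectedCalls {β : Type v} (p : PMF (β × ℕ)) : ℝ≥0∞ :=
  ∑' r : β × ℕ, p r * (r.2 : ℝ≥0∞)

/-! ### Streams -/

/-- An operation of the stream: the insertion or the deletion of an element. -/
inductive Op (V : Type u) : Type u
  | insertion (e : V)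
  | deletion (e : V)

section Streams

variable {V : Type u} [DecidableEq V]

/-- The set of available elements after an operation. -/
def Op.apply : Op V → Finset V → Finset V
  | .insertion e, U => insert e U
  | .deletion e, U => U.erase e

/-- The set of the elements that were inserted and not deleted during a stream that starts from the
empty set. -/
def available (ops : List (Op V)) : Finset V :=
  ops.foldl (fun U o => o.apply U) ∅

/-- An operation is admissible if it inserts an element that is not available, or deletes one that
is. -/
def Op.Admissible : Op V → Finset V → Prop
  | .insertion e, U => e ∉ U
  | .deletion e, U => e ∈ U

/-- A stream all of whose operations are admissible when they occur. -/
def IsStream (ops : List (Op V)) : Prop :=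
  ∀ (pre : List (Op V)) (o : Op V) (post : List (Op V)),
    ops = pre ++ o :: post → o.Admissible (available pre)

end Streams

/-! ### The algorithm -/

/-- The contents of one level of the data structure: the candidates `A`, the buffer `B`, the partial
solution `S` and the auxiliary set `S'`.  The partial solution is kept as a list, in decreasing
order of weights, and every element is stored with the weight that it had when it was added. -/
structure Level (V : Type u) where
  A : Finset V
  B : Finset V
  S : List (V × ℝ)
  S' : Finset V

/-- The empty level. -/
def Level.empty {V : Type u} : Level V := ⟨∅, ∅, [], ∅⟩

/-- The data structure for a stream with parameter `n = 2 ^ L`: the levels `0, …, L` (the later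
entries of `level` play no role), and the set `avail` of the elements that are currently
available. -/
structure DataStructure (V : Type u) where
  L : ℕ
  avail : Finset V
  level : ℕ → Level V

/-- Initialization for `n = 2 ^ L`. -/
def DataStructure.init {V : Type u} (L : ℕ) : DataStructure V :=
  ⟨L, ∅, fun _ => Level.empty⟩

/-- The level below level `l`.  Below level `0` there is a virtual level: its buffer holds all the
available elements, and its other sets are empty. -/
def DataStructure.prev {V : Type u} (D : DataStructure V) : ℕ → Level V
  | 0 => ⟨∅, D.avail, [], ∅⟩
  | l + 1 => D.level l

/-- What the independence oracle tells about an element `e` and a partial solution `S`: `S + e` is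
independent; or it is not, and `y`, with stored weight `wy`, is an element of least weight among the
`y ∈ S` with `S - y + e` independent; or there is no such `y`. -/
inductive Exchange (V : Type u) : Type u
  | free
  | swap (y : V) (wy : ℝ)
  | blocked

/-- The weight of a candidate, and how it can enter the partial solution. -/
structure Evaluation (V : Type u) where
  weight : ℝ
  exchange : Exchange V

/-- The first `i` elements of a partial solution. -/
def prefixSet {V : Type u} [DecidableEq V] (S : List (V × ℝ)) (i : ℕ) : Finset V :=
  ((S.take i).map Prod.fst).toFinset

section Algorithm

variable {V : Type u} [DecidableEq V]

/-- Binary search: given that the first `lo` elements of `S` together with `e` are independent and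
that the first `hi` ones together with `e` are not, find the largest `i < hi` such that the first
`i` elements together with `e` are independent. -/
def binarySearch (e : V) (S : List (V × ℝ)) (lo hi : ℕ) : OracleProg V ℕ :=
  if lo + 1 < hi then
    .indep (insert e (prefixSet S ((lo + hi) / 2))) fun b =>
      if b then binarySearch e S ((lo + hi) / 2) hi else binarySearch e S lo ((lo + hi) / 2)
  else .ret lo
termination_by hi - lo
decreasing_by all_goals omega

/-- Find the candidate swap `s_e` of `e` in the partial solution `S` by binary search. -/
def findSwap (e : V) (S : List (V × ℝ)) : OracleProg V (Exchange V) :=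
  .indep (insert e (prefixSet S S.length)) fun b =>
    if b then .ret .free
    else .indep {e} fun b' =>
      if b' then
        (binarySearch e S 0 S.length).bind fun i =>
          match S[i]? with
          | some p => .ret (.swap p.1 p.2)
          | none => .ret .blocked
      else .ret .blocked

/-- The `for` loop over the candidates: compute `w(e) = f(e | S')` and `s_e` for all `e` in the given
list. -/
def evaluateAll (S : List (V × ℝ)) (S' : Finset V) : List V → OracleProg V (V → Evaluation V)
  | [] => .ret fun _ => ⟨0, .blocked⟩
  | e :: es =>
      .value (insert e S') fun a => .value S' fun b =>
        (findSwap e S).bind fun x =>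
          (evaluateAll S S' es).bind fun ev => .ret (Function.update ev e ⟨a - b, x⟩)

/-- The candidates that are kept: `e ∈ E` (that is, `S + e` is independent) or `e ∈ F` (that is,
`S + e` is dependent and `w(e) > 2 w(s_e)`). -/
def Evaluation.Good (ev : Evaluation V) : Prop :=
  match ev.exchange with
  | .free => True
  | .swap _ wy => 2 * wy < ev.weight
  | .blocked => False

/-- `S + e - s_e`, where `e` is stored with its weight and the order by weight is maintained. -/
noncomputable def addSwap (S : List (V × ℝ)) (e : V) (ev : Evaluation V) : List (V × ℝ) :=
  List.orderedInsert (fun p q => q.2 ≤ p.2) (e, ev.weight)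
    (match ev.exchange with
      | .swap y _ => S.filter fun p => p.1 ≠ y
      | _ => S)

open Classical in
/-- The `repeat` loop of Level-Construct with threshold `t = n / 2 ^ l`: filter the candidates; if at
least `t` of them are left, pop a uniformly random one and add it to the solution; repeat until
fewer than `t` candidates are left.  The result is the final triple `(A, S, S')`. -/
noncomputable def repeatLoop (t : ℕ) (A : Finset V) (S : List (V × ℝ)) (S' : Finset V) :
    OracleProg V (Finset V × List (V × ℝ) × Finset V) :=
  (evaluateAll S S' A.toList).bind fun ev =>
    if h : t ≤ (A.filter fun e => (ev e).Good).card ∧ (A.filter fun e => (ev e).Good).Nonempty then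
      .sample (A.filter fun e => (ev e).Good) h.2 fun e =>
        if ((A.filter fun e => (ev e).Good).erase e).card < t then
          .ret ((A.filter fun e => (ev e).Good).erase e, addSwap S e (ev e), insert (e : V) S')
        else
          repeatLoop t ((A.filter fun e => (ev e).Good).erase e) (addSwap S e (ev e))
            (insert (e : V) S')
    else .ret (A.filter fun e => (ev e).Good, S, S')
termination_by A.card
decreasing_by
  exact lt_of_lt_of_le (Finset.card_erase_lt_of_mem e.2)
    (Finset.card_le_card (Finset.filter_subset _ _))

/-- Level-Construct at level `l`, followed by the levels above it. -/
noncomputable def levelConstruct (D : DataStructure V) (l : ℕ) : OracleProg V (DataStructure V) :=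
  (repeatLoop (2 ^ (D.L - l)) ((D.prev l).A ∪ (D.prev l).B) (D.prev l).S (D.prev l).S').bind fun r =>
    if l < D.L then
      levelConstruct { D with level := Function.update D.level l ⟨r.1, ∅, r.2.1, r.2.2⟩ } (l + 1)
    else .ret { D with level := Function.update D.level l ⟨r.1, ∅, r.2.1, r.2.2⟩ }
termination_by D.L - l
decreasing_by
  show D.L - (l + 1) < D.L - l
  omega

/-- The data structure after an element has been added to the available elements and to all
buffers. -/
def addToBuffers (e : V) (D : DataStructure V) : DataStructure V :=
  { D with
    avail := insert e D.avail
    level := fun l => { D.level l with B := insert e (D.level l).B } }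

/-- Insertion of `e`: add it to all buffers; then call Level-Construct at the smallest level whose
buffer has at least `n / 2 ^ l` elements. -/
noncomputable def insertElement (e : V) (D : DataStructure V) : OracleProg V (DataStructure V) :=
  match (List.range (D.L + 1)).find? fun l => 2 ^ (D.L - l) ≤ ((addToBuffers e D).level l).B.card with
  | some l => levelConstruct (addToBuffers e D) l
  | none => .ret (addToBuffers e D)

/-- The data structure after an element has been removed from the available elements, from all
candidate sets and from all buffers. -/
def removeFromSets (e : V) (D : DataStructure V) : DataStructure V :=
  { D with
    avail := D.avail.erase e
    level := fun l =>
      { D.level l with A := (D.level l).A.erase e, B := (D.level l).B.erase e } }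

/-- Deletion of `e`: remove it from all candidate sets and buffers; then, if it belongs to a partial
solution, call Level-Construct at the smallest level at which it does. -/
noncomputable def deleteElement (e : V) (D : DataStructure V) : OracleProg V (DataStructure V) :=
  match (List.range (D.L + 1)).find? fun l => e ∈ ((removeFromSets e D).level l).S.map Prod.fst with
  | some l => levelConstruct (removeFromSets e D) l
  | none => .ret (removeFromSets e D)

/-- One operation for a data structure with fixed parameter `n`. -/
noncomputable def applyOp : Op V → DataStructure V → OracleProg V (DataStructure V)
  | .insertion e, D => insertElement e D
  | .deletion e, D => deleteElement e D

/-- Insert the elements of a list one after the other. -/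
noncomputable def insertList : List V → DataStructure V → OracleProg V (DataStructure V)
  | [], D => .ret D
  | e :: es, D => (insertElement e D).bind (insertList es)

/-- The state of the algorithm that does not know the length of the stream: the number of operations
so far, and the data structure for the current value of `n`. -/
structure AlgState (V : Type u) where
  count : ℕ
  data : DataStructure V

/-- At the beginning `n = 1`. -/
def AlgState.init : AlgState V := ⟨0, DataStructure.init 0⟩

/-- The solution that the algorithm maintains: the partial solution at the last level. -/
def AlgState.solution (s : AlgState V) : Finset V :=
  ((s.data.level s.data.L).S.map Prod.fst).toFinset

/-- Process one operation.  When the number of operations reaches `n`, then `n` is doubled and the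
data structure is built anew by inserting the available elements one after the other. -/
noncomputable def step (o : Op V) (s : AlgState V) : OracleProg V (AlgState V) :=
  (applyOp o s.data).bind fun D =>
    if s.count + 1 = 2 ^ D.L then
      (insertList D.avail.toList (DataStructure.init (D.L + 1))).bind fun D' =>
        .ret ⟨s.count + 1, D'⟩
    else .ret ⟨s.count + 1, D⟩

/-- Process the operations of a list one after the other. -/
noncomputable def process : List (Op V) → AlgState V → OracleProg V (AlgState V)
  | [], s => .ret s
  | o :: os, s => (step o s).bind (process os)

/-- The distribution of the final state and of the total number of oracle calls when the dynamic
algorithm processes the stream `ops`. -/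
noncomputable def outcome (f : Finset V → ℝ) (M : Matroid V) (ops : List (Op V)) :
    PMF (AlgState V × ℕ) :=
  (process ops AlgState.init).run f M

end Algorithm

end DynSubmod

/-! Approximation. Every level keeps f(S') ≤ 2 w(S), where w(S) is the sum of the stored weights: a
new element raises f(S') by its weight, and w(S) by more than half of it even in a swap, since the
outgoing weight is less than half the incoming one. Moreover w(S) ≤ f(S) by submodularity, as
weights are gains over supersets of the current solution. An available element that is no longer a
candidate is covered: it entered S', is a loop, or is spanned by the elements of S weighing at least
half its gain over S'. The swap partner closes a circuit with e and heavier elements, so no swap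
shrinks the span of the elements above any threshold, and coverage persists. For independent T,
comparing ranks at each threshold bounds the gains of T \ S' over S' by 2 w(S) in total, whence f(T)
≤ 4 w(S) ≤ 4 f(S) once everything is covered (`IsSolution.approx`). At the last level the threshold
is 1, so no candidate is left there. None of this depends on the random choices.

Cost. A swap more than doubles a weight, so counting weight classes by powers of two allows at most
K = k(2 + log Δ) additions per loop (`isRank_weightClass`). Expected cost is bounded by a potential
that looks into the future of the stream, which is legitimate because the stream is fixed in
advance. With t = 2^(L-l), level l holds u for each buffered element, plus the maximum, over the
elements it added to the solution, of a charge: u t minus w for each operation up to the next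
deletion of the element. A rebuild starting at level l is paid for by its full buffer or by the
charge of the deleted element. One operation deletes at most one element, so all charges together
are at most (u t)²/w (`mul_sum_charge_le`), and a uniformly random one of at least t candidates has
a small charge on average. With u = 32Kq and w = 4Ku, where q bounds the calls per evaluation, the
new charges, the evaluations and the rebuild of the next levels fit into u t
(`CostBounds.ecost_levelConstruct`). Each operation thus costs u + w per level, and doubling n costs
a constant factor more. -/

namespace DynSubmod

open scoped ENNReal

universe u v w

/-! ### Reasoning about randomized oracle programs -/

namespace OracleProg

variable {V : Type u} {β : Type v} {γ : Type w} (f : Finset V → ℝ) (M : Matroid V)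

open Classical in
/-- All possible results of a program satisfy `Q`. -/
def Sat (Q : β → Prop) : OracleProg V β → Prop
  | ret b => Q b
  | value T next => (next (f T)).Sat Q
  | indep T next => (next (decide (M.Indep (T : Set V)))).Sat Q
  | sample _ _ next => ∀ a, (next a).Sat Q

open Classical in
/-- The expectation of the number of oracle calls plus the value of `φ` at the result. -/
noncomputable def ecost (φ : β → ℝ≥0∞) : OracleProg V β → ℝ≥0∞
  | ret b => φ b
  | value T next => 1 + (next (f T)).ecost φ
  | indep T next => 1 + (next (decide (M.Indep (T : Set V)))).ecost φ
  | sample A _ next => (∑ a : A, (next a).ecost φ) / (A.card : ℝ≥0∞)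

variable {f M}

theorem Sat.mono {Q R : β → Prop} {p : OracleProg V β} (h : p.Sat f M Q) (hQR : ∀ b, Q b → R b) :
    p.Sat f M R := by
  induction p with
  | ret b => exact hQR b h
  | value T next ih => exact ih _ h
  | indep T next ih => exact ih _ h
  | sample A hA next ih => exact fun a => ih a (h a)

theorem Sat.bind {Q : β → Prop} {R : γ → Prop} {p : OracleProg V β} {g : β → OracleProg V γ}
    (h : p.Sat f M Q) (hg : ∀ b, Q b → (g b).Sat f M R) : (p.bind g).Sat f M R := by
  induction p with
  | ret b => exact hg b h
  | value T next ih => exact ih _ h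
  | indep T next ih => exact ih _ h
  | sample A hA next ih => exact fun a => ih a (h a)

theorem Sat.of_mem_support {Q : β → Prop} {p : OracleProg V β} (h : p.Sat f M Q) {r : β × ℕ}
    (hr : r ∈ (p.run f M).support) : Q r.1 := by
  induction p generalizing r with
  | ret b =>
    simp only [run, PMF.support_pure, Set.mem_singleton_iff] at hr
    subst hr
    exact h
  | value T next ih =>
    simp only [run, PMF.support_map, Set.mem_image] at hr
    obtain ⟨r', hr', rfl⟩ := hr
    exact ih _ h (r := r') hr'
  | indep T next ih =>
    simp only [run, PMF.support_map, Set.mem_image] at hr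
    obtain ⟨r', hr', rfl⟩ := hr
    exact ih _ h (r := r') hr'
  | sample A hA next ih =>
    simp only [run, PMF.mem_support_bind_iff] at hr
    obtain ⟨a, -, hr'⟩ := hr
    exact ih a (h a) hr'

theorem ecost_bind (φ : γ → ℝ≥0∞) (p : OracleProg V β) (g : β → OracleProg V γ) :
    (p.bind g).ecost f M φ = p.ecost f M fun b => (g b).ecost f M φ := by
  induction p with
  | ret b => rfl
  | value T next ih => simp only [OracleProg.bind, ecost, ih]
  | indep T next ih => simp only [OracleProg.bind, ecost, ih]
  | sample A hA next ih => simp only [OracleProg.bind, ecost, ih]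

theorem Sat.ecost_mono {Q : β → Prop} {p : OracleProg V β} (h : p.Sat f M Q) {φ ψ : β → ℝ≥0∞}
    (hφ : ∀ b, Q b → φ b ≤ ψ b) : p.ecost f M φ ≤ p.ecost f M ψ := by
  induction p with
  | ret b => exact hφ b h
  | value T next ih => exact add_le_add_right (ih _ h) 1
  | indep T next ih => exact add_le_add_right (ih _ h) 1
  | sample A hA next ih =>
    exact ENNReal.div_le_div_right (Finset.sum_le_sum fun a _ => ih a (h a)) _

theorem ecost_add_const (φ : β → ℝ≥0∞) (c : ℝ≥0∞) (p : OracleProg V β) :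
    p.ecost f M (fun b => φ b + c) = p.ecost f M φ + c := by
  induction p with
  | ret b => rfl
  | value T next ih => simp only [ecost, ih, add_assoc]
  | indep T next ih => simp only [ecost, ih, add_assoc]
  | sample A hA next ih =>
    have h0 : (A.card : ℝ≥0∞) ≠ 0 := by simpa using hA.ne_empty
    simp only [ecost, ih, Finset.sum_add_distrib, ENNReal.add_div]
    congr 1
    simp only [Finset.sum_const, Finset.card_univ, Fintype.card_coe, nsmul_eq_mul]
    rw [mul_div_assoc]
    exact ENNReal.mul_div_cancel h0 (ENNReal.natCast_ne_top _)

/-- The rule for sequential composition. -/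
theorem ecost_bind_le {Q : β → Prop} {p : OracleProg V β} {g : β → OracleProg V γ}
    {φ : γ → ℝ≥0∞} {c : ℝ≥0∞} (ψ : β → ℝ≥0∞) (h : p.Sat f M Q) (hp : p.ecost f M ψ ≤ c)
    (hg : ∀ b, Q b → (g b).ecost f M φ ≤ ψ b) : (p.bind g).ecost f M φ ≤ c := by
  rw [ecost_bind]
  exact (h.ecost_mono hg).trans hp

theorem tsum_bind_mul {α : Type*} {δ : Type*} (p : PMF α) (g : α → PMF δ) (h : δ → ℝ≥0∞) :
    ∑' b, (p.bind g) b * h b = ∑' a, p a * ∑' b, g a b * h b := by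
  simp only [PMF.bind_apply, ← ENNReal.tsum_mul_right, ← ENNReal.tsum_mul_left]
  rw [ENNReal.tsum_comm]
  simp only [mul_assoc]

theorem expectedCalls_map_succ (p : PMF (β × ℕ)) :
    expectedCalls (p.map fun r => (r.1, r.2 + 1)) = 1 + expectedCalls p := by
  unfold expectedCalls
  rw [PMF.map, tsum_bind_mul]
  have h1 : ∀ a : β × ℕ, ∑' b : β × ℕ,
      ((PMF.pure ∘ fun r : β × ℕ => (r.1, r.2 + 1)) a) b * (b.2 : ℝ≥0∞) = (a.2 : ℝ≥0∞) + 1 := by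
    intro a
    rw [tsum_eq_single (a.1, a.2 + 1)]
    · simp
    · intro b hb
      simp [PMF.pure_apply, hb]
  simp only [h1, mul_add, mul_one, ENNReal.tsum_add, PMF.tsum_coe]
  exact add_comm _ _

/-- The expected number of oracle calls is computed recursively. -/
theorem expectedCalls_run (p : OracleProg V β) :
    expectedCalls (p.run f M) = p.ecost f M fun _ => 0 := by
  induction p with
  | ret b =>
    unfold expectedCalls
    rw [run, tsum_eq_single (b, 0)]
    · simp [ecost]
    · intro r hr
      simp [PMF.pure_apply, hr]
  | value T next ih => simp only [run, ecost, expectedCalls_map_succ, ih]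
  | indep T next ih => simp only [run, ecost, expectedCalls_map_succ, ih]
  | sample A hA next ih =>
    have : Nonempty A := hA.to_subtype
    simp only [run, ecost, ← ih]
    unfold expectedCalls
    rw [tsum_bind_mul, tsum_fintype]
    simp only [PMF.uniformOfFintype_apply, Fintype.card_coe, ENNReal.div_eq_inv_mul,
      Finset.mul_sum]

end OracleProg

/-! ### Marginal gains -/

section Marginal

variable {V : Type u} [DecidableEq V] {f : Finset V → ℝ}

theorem marginal_nonneg (hm : Monotone f) (x : V) (T : Finset V) : 0 ≤ marginal f x T :=
  sub_nonneg.2 (hm (Finset.subset_insert x T))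

theorem marginal_eq_zero_of_mem {x : V} {T : Finset V} (h : x ∈ T) : marginal f x T = 0 := by
  simp [marginal, Finset.insert_eq_of_mem h]

theorem marginal_antitone (hm : Monotone f) (hs : IsSubmodular f) (x : V) {X Y : Finset V}
    (h : X ⊆ Y) : marginal f x Y ≤ marginal f x X := by
  by_cases hx : x ∈ Y
  · rw [marginal_eq_zero_of_mem hx]
    exact marginal_nonneg hm x X
  · exact hs X Y h x hx

theorem value_union_le (hm : Monotone f) (hs : IsSubmodular f) (S T : Finset V) :
    f (S ∪ T) ≤ f S + ∑ x ∈ T, marginal f x S := by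
  induction T using Finset.induction_on with
  | empty => simp
  | insert x T hx ih =>
    rw [Finset.sum_insert hx, Finset.union_insert]
    have h := marginal_antitone hm hs x (Finset.subset_union_left (s₁ := S) (s₂ := T))
    unfold marginal at h ih ⊢
    linarith

end Marginal

/-- Domination of counts implies domination of sums. -/
theorem sum_le_sum_of_card_filter_le {α : Type u} {β : Type v} [DecidableEq α] [DecidableEq β]
    (X : Finset α) (Y : Finset β) (a : α → ℝ) (b : β → ℝ) (hb : ∀ y ∈ Y, 0 ≤ b y)
    (h : ∀ c : ℝ, 0 < c → (X.filter fun x => c ≤ a x).card ≤ (Y.filter fun y => c ≤ b y).card) :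
    ∑ x ∈ X, a x ≤ ∑ y ∈ Y, b y := by
  induction hn : X.card generalizing X Y with
  | zero =>
    rw [Finset.card_eq_zero.1 hn, Finset.sum_empty]
    exact Finset.sum_nonneg hb
  | succ n ih =>
    have hne : X.Nonempty := Finset.card_pos.1 (by omega)
    obtain ⟨x, hx, hxmax⟩ := X.exists_max_image a hne
    -- A largest a x is matched with some b y ≥ a x, which the count at threshold a x provides.
    -- Removing the pair lowers both counts by one at thresholds up to a x, and above it the left
    -- count is zero.
    rcases le_or_gt (a x) 0 with h0 | h0
    · exact (Finset.sum_nonpos fun z hz => (hxmax z hz).trans h0).trans (Finset.sum_nonneg hb)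
    · have h1 : 0 < (Y.filter fun y => a x ≤ b y).card :=
        lt_of_lt_of_le (Finset.card_pos.2 ⟨x, by simp [hx]⟩) (h _ h0)
      obtain ⟨y, hy⟩ := Finset.card_pos.1 h1
      rw [Finset.mem_filter] at hy
      rw [← Finset.add_sum_erase X a hx, ← Finset.add_sum_erase Y b hy.1]
      refine add_le_add hy.2 (ih _ _ (fun z hz => hb z (Finset.mem_of_mem_erase hz)) ?_ ?_)
      · intro c hc
        rcases le_or_gt c (a x) with hcx | hcx
        · rw [Finset.filter_erase, Finset.filter_erase,
            Finset.card_erase_of_mem (by simp [hx, hcx]),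
            Finset.card_erase_of_mem (by simp [hy.1, hcx.trans hy.2])]
          exact Nat.sub_le_sub_right (h c hc) 1
        · rw [Finset.filter_eq_empty_iff.2, Finset.card_empty]
          · exact Nat.zero_le _
          · intro z hz hcz
            exact absurd (hxmax z (Finset.mem_of_mem_erase hz)) (not_le.2 (hcx.trans_le hcz))
      · rw [Finset.card_erase_of_mem hx, hn]
        rfl

/-! ### Partial solutions -/

section Weights

variable {V : Type u}

/-- The total weight of a partial solution. -/
def totalWeight (S : List (V × ℝ)) : ℝ := (S.map Prod.snd).sum

theorem totalWeight_perm {R S : List (V × ℝ)} (h : R.Perm S) : totalWeight R = totalWeight S :=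
  (h.map _).sum_eq

theorem totalWeight_cons (p : V × ℝ) (S : List (V × ℝ)) :
    totalWeight (p :: S) = p.2 + totalWeight S := by
  simp [totalWeight]

/-- The span of the elements of weight at least `c`. -/
def heavySpan (M : Matroid V) (c : ℝ) (S : List (V × ℝ)) : Set V :=
  M.closure {y | ∃ w, (y, w) ∈ S ∧ c ≤ w}

theorem heavySpan_anti (M : Matroid V) {c d : ℝ} (h : d ≤ c) (S : List (V × ℝ)) :
    heavySpan M c S ⊆ heavySpan M d S :=
  M.closure_subset_closure fun _ ⟨w, hw, hcw⟩ => ⟨w, hw, h.trans hcw⟩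

theorem heavySpan_subset (M : Matroid V) {c : ℝ} {R S : List (V × ℝ)} (h : R ⊆ S) :
    heavySpan M c R ⊆ heavySpan M c S :=
  M.closure_subset_closure fun _ ⟨w, hw, hcw⟩ => ⟨w, h hw, hcw⟩

end Weights

section PartialSolution

variable {V : Type u} [DecidableEq V] {f : Finset V → ℝ} {M : Matroid V}

/-- The elements of a partial solution. -/
def elems (S : List (V × ℝ)) : Finset V := (S.map Prod.fst).toFinset

theorem mem_elems {S : List (V × ℝ)} {x : V} : x ∈ elems S ↔ ∃ w, (x, w) ∈ S := by
  simp [elems]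

theorem elems_mono {R S : List (V × ℝ)} (h : R ⊆ S) : elems R ⊆ elems S := by
  intro x hx
  obtain ⟨w, hw⟩ := mem_elems.1 hx
  exact mem_elems.2 ⟨w, h hw⟩

theorem elems_perm {R S : List (V × ℝ)} (h : R.Perm S) : elems R = elems S :=
  (elems_mono h.subset).antisymm (elems_mono h.symm.subset)

theorem elems_cons (p : V × ℝ) (S : List (V × ℝ)) : elems (p :: S) = insert p.1 (elems S) := by
  simp [elems]

theorem elems_append (R S : List (V × ℝ)) : elems (R ++ S) = elems R ∪ elems S := by
  simp [elems]

/-- The part of a partial solution that stays when a new element enters. -/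
def staying (S : List (V × ℝ)) : Exchange V → List (V × ℝ)
  | .swap y _ => S.filter fun p => p.1 ≠ y
  | _ => S

theorem addSwap_eq (S : List (V × ℝ)) (e : V) (ev : Evaluation V) :
    addSwap S e ev =
      List.orderedInsert (fun p q => q.2 ≤ p.2) (e, ev.weight) (staying S ev.exchange) := by
  unfold addSwap staying
  cases ev.exchange <;> rfl

theorem addSwap_perm (S : List (V × ℝ)) (e : V) (ev : Evaluation V) :
    (addSwap S e ev).Perm ((e, ev.weight) :: staying S ev.exchange) := by
  rw [addSwap_eq]
  exact List.perm_orderedInsert _ _ _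

theorem staying_sublist (S : List (V × ℝ)) (x : Exchange V) : (staying S x).Sublist S := by
  cases x with
  | swap y w => exact List.filter_sublist
  | free => exact List.Sublist.refl _
  | blocked => exact List.Sublist.refl _

theorem staying_swap {l₁ l₂ : List (V × ℝ)} {y : V} {w : ℝ}
    (h : ((l₁ ++ (y, w) :: l₂).map Prod.fst).Nodup) :
    staying (l₁ ++ (y, w) :: l₂) (.swap y w) = l₁ ++ l₂ := by
  simp only [List.map_append, List.map_cons, List.nodup_middle, List.nodup_cons, List.mem_append,
    List.mem_map, not_or, not_exists, not_and] at h
  simp only [staying, List.filter_append, List.filter_cons, ne_eq, not_true_eq_false, decide_false]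
  congr 1
  · exact List.filter_eq_self.2 fun p hp => by simpa using h.1.1 p hp
  · simpa using fun a b hp => h.1.2 (a, b) hp

variable (f M) in
/-- The invariant of the partial solution `S` and the auxiliary set `S'`. -/
structure IsPartial (S : List (V × ℝ)) (S' : Finset V) : Prop where
  nodup : (S.map Prod.fst).Nodup
  sorted : S.Pairwise fun p q => q.2 ≤ p.2
  indep : M.Indep (elems S : Set V)
  subset : elems S ⊆ S'
  weight : ∀ p ∈ S, ∃ x T, p.2 = marginal f x T
  le_value : ∀ Y : Finset V, (S.map fun p => if p.1 ∈ Y then p.2 else 0).sum ≤ f Y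

theorem IsPartial.weight_nonneg {S : List (V × ℝ)} {S' : Finset V} (h : IsPartial f M S S')
    (hm : Monotone f) {p : V × ℝ} (hp : p ∈ S) : 0 ≤ p.2 := by
  obtain ⟨x, T, hw⟩ := h.weight p hp
  rw [hw]
  exact marginal_nonneg hm x T

theorem IsPartial.nil (h0 : f ∅ = 0) (hm : Monotone f) : IsPartial f M [] ∅ where
  nodup := List.nodup_nil
  sorted := List.Pairwise.nil
  indep := by simp [elems]
  subset := by simp [elems]
  weight := by simp
  le_value Y := by simpa [h0] using hm (Finset.empty_subset Y)

/-- Weights are gains of a monotone function, hence nonnegative, so dropping elements only lowers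
the sums in `le_value`. -/
theorem IsPartial.sublist {R S : List (V × ℝ)} {S' : Finset V} (h : IsPartial f M S S')
    (hm : Monotone f) (hR : R.Sublist S) : IsPartial f M R S' where
  nodup := h.nodup.sublist (hR.map _)
  sorted := h.sorted.sublist hR
  indep := h.indep.subset (by exact_mod_cast elems_mono hR.subset)
  subset := (elems_mono hR.subset).trans h.subset
  weight p hp := h.weight p (hR.subset hp)
  le_value Y := by
    refine le_trans ?_ (h.le_value Y)
    refine (hR.map _).sum_le_sum fun x hx => ?_
    obtain ⟨p, hp, rfl⟩ := List.mem_map.1 hx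
    split_ifs
    · exact h.weight_nonneg hm hp
    · exact le_rfl

/-- Since Y ∩ elems S lies in S', submodularity bounds the new weight by the gain of e over Y ∩
elems S. This step is why `le_value` ranges over all sets Y. -/
theorem IsPartial.orderedInsert {S : List (V × ℝ)} {S' : Finset V} (h : IsPartial f M S S')
    (hm : Monotone f) (hs : IsSubmodular f) {e : V} (he : e ∉ elems S)
    (hi : M.Indep (insert e (elems S) : Finset V)) :
    IsPartial f M (List.orderedInsert (fun p q => q.2 ≤ p.2) (e, marginal f e S') S)
      (insert e S') := by
  have hp := List.perm_orderedInsert (fun p q : V × ℝ => q.2 ≤ p.2) (e, marginal f e S') S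
  have hel : elems (List.orderedInsert (fun p q => q.2 ≤ p.2) (e, marginal f e S') S)
      = insert e (elems S) := by
    rw [elems_perm hp, elems_cons]
  refine ⟨?_, ?_, ?_, ?_, ?_, ?_⟩
  · rw [(hp.map _).nodup_iff, List.map_cons, List.nodup_cons]
    exact ⟨by simpa [elems] using he, h.nodup⟩
  · have : Std.Total fun p q : V × ℝ => q.2 ≤ p.2 := ⟨fun p q => le_total _ _⟩
    have : IsTrans (V × ℝ) fun p q => q.2 ≤ p.2 := ⟨fun p q r h1 h2 => h2.trans h1⟩
    exact h.sorted.orderedInsert _ _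
  · rwa [hel]
  · rw [hel]
    exact Finset.insert_subset_insert e h.subset
  · intro p hp'
    rcases List.mem_cons.1 (hp.subset hp') with rfl | hp'
    · exact ⟨e, S', rfl⟩
    · exact h.weight p hp'
  · intro Y
    rw [(hp.map _).sum_eq, List.map_cons, List.sum_cons]
    by_cases heY : e ∈ Y
    · have h1 := h.le_value (Y ∩ elems S)
      have h2 : (S.map fun p => if p.1 ∈ Y then p.2 else 0)
          = S.map fun p => if p.1 ∈ Y ∩ elems S then p.2 else 0 := by
        refine List.map_congr_left fun p hp' => ?_
        have : p.1 ∈ elems S := mem_elems.2 ⟨p.2, hp'⟩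
        simp [this]
      have h3 := marginal_antitone hm hs e
        ((Finset.inter_subset_right (s₁ := Y) (s₂ := elems S)).trans h.subset)
      have h4 : f (insert e (Y ∩ elems S)) ≤ f Y :=
        hm (Finset.insert_subset heY Finset.inter_subset_left)
      rw [h2]
      simp only [heY, if_true]
      unfold marginal at h3 ⊢
      linarith
    · simpa [heY] using h.le_value Y

theorem IsPartial.totalWeight_le {S : List (V × ℝ)} {S' : Finset V} (h : IsPartial f M S S') :
    totalWeight S ≤ f (elems S) := by
  refine le_trans (le_of_eq ?_) (h.le_value (elems S))
  unfold totalWeight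
  congr 1
  refine List.map_congr_left fun p hp => ?_
  rw [if_pos (mem_elems.2 ⟨p.2, hp⟩)]

theorem IsPartial.card_elems {S : List (V × ℝ)} {S' : Finset V} (h : IsPartial f M S S') :
    (elems S).card = S.length := by
  rw [elems, List.toFinset_card_of_nodup h.nodup, List.length_map]

theorem IsPartial.length_le {S : List (V × ℝ)} {S' : Finset V} (h : IsPartial f M S S') {k : ℕ}
    (hk : M.eRank = k) : S.length ≤ k := by
  have h1 := h.indep.encard_le_eRank
  rw [hk, Set.encard_coe_eq_coe_finsetCard, h.card_elems] at h1
  exact_mod_cast h1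

/-! ### Candidate swaps -/

/-- The specification of the exchange found for `e`. -/
def ExchangeSpec (M : Matroid V) (S : List (V × ℝ)) (e : V) : Exchange V → Prop
  | .free => M.Indep (insert e (elems S) : Finset V)
  | .swap y w => ∃ l₁ l₂, S = l₁ ++ (y, w) :: l₂ ∧ M.Indep (insert e (elems l₁) : Finset V) ∧
      ¬ M.Indep (insert e (insert y (elems l₁)) : Finset V)
  | .blocked => ¬ M.Indep ({e} : Finset V)

section Swap

variable {l₁ l₂ : List (V × ℝ)} {S' : Finset V} {y e : V} {w : ℝ}

theorem IsPartial.notMem_closure_of_swap (h : IsPartial f M (l₁ ++ (y, w) :: l₂) S') :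
    y ∉ M.closure (elems (l₁ ++ l₂)) := by
  have hel : elems (l₁ ++ (y, w) :: l₂) = insert y (elems (l₁ ++ l₂)) := by
    rw [elems_perm (List.perm_middle), elems_cons]
  have hy : y ∉ elems (l₁ ++ l₂) := by
    have := h.nodup
    simp only [List.map_append, List.map_cons, List.nodup_middle, List.nodup_cons] at this
    simpa [elems] using this.1
  have h1 := h.indep
  rw [hel] at h1
  have h2 := h1.notMem_closure_sdiff_of_mem (e := y) (by simp)
  simpa [Set.insert_sdiff_self_of_notMem, hy] using h2

/-- The circuit in l₁ + y + e contains both y and e, so each is spanned by the other together with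
l₁. -/
theorem swap_mem_closure (hd : ¬ M.Indep (insert e (insert y (elems l₁)) : Finset V))
    (hi : M.Indep (insert e (elems l₁) : Finset V)) (hy : y ∈ M.E) :
    y ∈ M.closure (insert e (elems l₁) : Finset V) := by
  rw [hi.mem_closure_iff']
  refine ⟨hy, fun h => absurd ?_ hd⟩
  rw [Finset.insert_comm]
  simpa using h

theorem candidate_mem_closure (hd : ¬ M.Indep (insert e (insert y (elems l₁)) : Finset V))
    (hi : M.Indep (insert e (elems l₁) : Finset V))
    (hy : M.Indep (insert y (elems l₁) : Finset V)) :
    e ∈ M.closure (insert y (elems l₁) : Finset V) := by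
  rw [hy.mem_closure_iff']
  refine ⟨hi.subset_ground (by simp), fun h => absurd ?_ hd⟩
  simpa using h

/-- If the remaining elements spanned e, they would also span y, which lies in the span of l₁ + e;
this contradicts the independence of the old solution. -/
theorem IsPartial.indep_swap (h : IsPartial f M (l₁ ++ (y, w) :: l₂) S')
    (hi : M.Indep (insert e (elems l₁) : Finset V))
    (hd : ¬ M.Indep (insert e (insert y (elems l₁)) : Finset V)) (hm : Monotone f) :
    M.Indep (insert e (elems (l₁ ++ l₂)) : Finset V) := by
  have hR := (h.sublist hm (((List.Sublist.refl l₁).append (List.sublist_cons_self _ l₂)))).indep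
  have hyE : y ∈ M.E := h.indep.subset_ground (by simp [elems])
  rw [Finset.coe_insert, hR.insert_indep_iff]
  refine Or.inl ⟨hi.subset_ground (by simp), fun he => h.notMem_closure_of_swap ?_⟩
  have h2 := swap_mem_closure hd hi hyE
  refine M.closure_subset_closure_of_subset_closure ?_ h2
  rw [Finset.coe_insert]
  refine Set.insert_subset he (subset_trans ?_ (M.subset_closure _ hR.subset_ground))
  exact_mod_cast elems_mono (List.subset_append_left l₁ l₂)

theorem IsPartial.le_weight_left (h : IsPartial f M (l₁ ++ (y, w) :: l₂) S') {p : V × ℝ}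
    (hp : p ∈ l₁) : w ≤ p.2 :=
  (List.pairwise_append.1 h.sorted).2.2 p hp (y, w) (by simp)

theorem IsPartial.prefix_subset_heavySpan (h : IsPartial f M (l₁ ++ (y, w) :: l₂) S')
    {R : List (V × ℝ)} (hR : l₁ ⊆ R) (hRi : (elems R : Set V) ⊆ M.E) :
    (elems l₁ : Set V) ⊆ heavySpan M w R := by
  intro x hx
  obtain ⟨v, hv⟩ := mem_elems.1 (Finset.mem_coe.1 hx)
  exact M.mem_closure_of_mem' ⟨v, hR hv, h.le_weight_left hv⟩ (hRi (elems_mono hR hx))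

/-- A candidate is spanned by the elements that weigh at least as much as its candidate swap. -/
theorem IsPartial.mem_heavySpan_of_swap (h : IsPartial f M (l₁ ++ (y, w) :: l₂) S')
    (hi : M.Indep (insert e (elems l₁) : Finset V))
    (hd : ¬ M.Indep (insert e (insert y (elems l₁)) : Finset V)) :
    e ∈ heavySpan M w (l₁ ++ (y, w) :: l₂) := by
  have h1 : M.Indep (insert y (elems l₁) : Finset V) :=
    h.indep.subset (by
      rw [elems_append, elems_cons]
      intro x
      simp
      tauto)
  have h2 := candidate_mem_closure hd hi h1
  refine M.closure_subset_closure_of_subset_closure ?_ h2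
  rw [Finset.coe_insert]
  refine Set.insert_subset ?_
    (h.prefix_subset_heavySpan (List.subset_append_left _ _) h.indep.subset_ground)
  exact M.mem_closure_of_mem' ⟨w, by simp, le_rfl⟩ (h1.subset_ground (by simp))

/-- A swap does not shrink the spans of heavy elements. -/
theorem IsPartial.heavySpan_swap_subset (h : IsPartial f M (l₁ ++ (y, w) :: l₂) S')
    (hi : M.Indep (insert e (elems l₁) : Finset V))
    (hd : ¬ M.Indep (insert e (insert y (elems l₁)) : Finset V)) (hm : Monotone f) {v : ℝ}
    (hv : w ≤ v) (c : ℝ) :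
    heavySpan M c (l₁ ++ (y, w) :: l₂) ⊆ heavySpan M c ((e, v) :: (l₁ ++ l₂)) := by
  have hR := h.indep_swap hi hd hm
  have hyE : y ∈ M.E := h.indep.subset_ground (by simp [elems])
  have hsub : (elems ((e, v) :: (l₁ ++ l₂)) : Set V) ⊆ M.E := by
    rw [elems_cons]
    exact hR.subset_ground
  have hy : y ∈ heavySpan M w ((e, v) :: (l₁ ++ l₂)) := by
    refine M.closure_subset_closure_of_subset_closure ?_ (swap_mem_closure hd hi hyE)
    rw [Finset.coe_insert]
    refine Set.insert_subset ?_ (h.prefix_subset_heavySpan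
      (fun p hp => List.mem_cons_of_mem _ (List.mem_append_left _ hp)) hsub)
    exact M.mem_closure_of_mem' ⟨v, by simp, hv⟩ (hi.subset_ground (by simp))
  refine M.closure_subset_closure_of_subset_closure ?_
  rintro x ⟨v', hx, hc⟩
  rcases List.mem_cons.1 (List.perm_middle.subset hx) with hx | hx
  · obtain ⟨rfl, rfl⟩ := Prod.mk.inj hx
    exact heavySpan_anti M hc _ hy
  · exact M.mem_closure_of_mem' ⟨v', List.mem_cons_of_mem _ hx, hc⟩
      (hsub (mem_elems.2 ⟨v', List.mem_cons_of_mem _ hx⟩))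

end Swap

/-! ### Solutions -/

variable (f M) in
/-- The invariant of the partial solution `S` and the auxiliary set `S'`, together with the bound
for the value of `S'`. -/
structure IsSolution (S : List (V × ℝ)) (S' : Finset V) : Prop extends IsPartial f M S S' where
  value_le : f S' ≤ 2 * totalWeight S

theorem IsSolution.nil (h0 : f ∅ = 0) (hm : Monotone f) : IsSolution f M [] ∅ :=
  ⟨IsPartial.nil h0 hm, by simp [h0, totalWeight]⟩

variable (f M) in
/-- The specification of the evaluation of `e`. -/
def EvalSpec (S : List (V × ℝ)) (S' : Finset V) (e : V) (ev : Evaluation V) : Prop :=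
  ev.weight = marginal f e S' ∧ ExchangeSpec M S e ev.exchange

/-- The factor 2 in the acceptance test gives `value_le`: w(e) - w(s_e) > w(e)/2, while f(S') grows
by exactly w(e). -/
theorem IsSolution.addSwap {S : List (V × ℝ)} {S' : Finset V} (h : IsSolution f M S S')
    (hm : Monotone f) (hs : IsSubmodular f) {e : V} {ev : Evaluation V} (he : e ∉ elems S)
    (hev : EvalSpec f M S S' e ev) (hg : ev.Good) :
    IsSolution f M (addSwap S e ev) (insert e S') := by
  obtain ⟨wt, x⟩ := ev
  obtain ⟨hw, hx⟩ := hev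
  dsimp only at hw hx
  subst hw
  have hval : f (insert e S') = f S' + marginal f e S' := by
    unfold marginal
    ring
  have hnn := marginal_nonneg hm e S'
  have h1 := h.value_le
  have hst := h.toIsPartial.sublist hm (staying_sublist S x)
  have he' : e ∉ elems (staying S x) := fun hmem =>
    he (elems_mono (staying_sublist S x).subset hmem)
  refine ⟨?_, ?_⟩
  · rw [addSwap_eq]
    refine hst.orderedInsert hm hs he' ?_
    cases x with
    | free => exact hx
    | blocked => exact hg.elim
    | swap y w =>
      obtain ⟨l₁, l₂, rfl, hi, hd⟩ := hx
      rw [staying_swap h.nodup]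
      exact h.indep_swap hi hd hm
  · rw [totalWeight_perm (addSwap_perm S e _), totalWeight_cons, hval]
    cases x with
    | free =>
      simp only [staying]
      linarith
    | blocked => exact hg.elim
    | swap y w =>
      obtain ⟨l₁, l₂, rfl, hi, hd⟩ := hx
      have hg' : 2 * w < marginal f e S' := hg
      rw [staying_swap h.nodup]
      rw [totalWeight_perm List.perm_middle, totalWeight_cons] at h1
      dsimp only at h1 ⊢
      linarith

/-- Good candidates do not shrink the spans of heavy elements. -/
theorem IsSolution.heavySpan_subset_addSwap {S : List (V × ℝ)} {S' : Finset V}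
    (h : IsSolution f M S S') (hm : Monotone f) {e : V} {ev : Evaluation V}
    (hev : EvalSpec f M S S' e ev) (hg : ev.Good) (c : ℝ) :
    heavySpan M c S ⊆ heavySpan M c (DynSubmod.addSwap S e ev) := by
  obtain ⟨wt, x⟩ := ev
  obtain ⟨hw, hx⟩ := hev
  dsimp only at hw hx
  subst hw
  refine subset_trans ?_ (heavySpan_subset M (addSwap_perm S e _).symm.subset)
  cases x with
  | free => exact heavySpan_subset M (List.subset_cons_self _ _)
  | blocked => exact hg.elim
  | swap y w =>
    obtain ⟨l₁, l₂, rfl, hi, hd⟩ := hx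
    have hg' : 2 * w < marginal f e S' := hg
    have hw0 : 0 ≤ w := h.weight_nonneg hm (p := (y, w)) (by simp)
    dsimp only
    rw [staying_swap h.nodup]
    exact h.heavySpan_swap_subset hi hd hm (by linarith) c

variable (f M) in
/-- An element that need not be considered any more: it was added to `S'`, or it is a loop, or it is
spanned by the elements of `S` of at least half its weight. -/
def Covered (S : List (V × ℝ)) (S' : Finset V) (e : V) : Prop :=
  e ∈ S' ∨ ¬ M.Indep ({e} : Finset V) ∨ e ∈ heavySpan M (marginal f e S' / 2) S

/-- Heavy spans only grow, and gains over a larger S' only shrink, so the threshold to be met only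
falls. -/
theorem IsSolution.covered_addSwap {S : List (V × ℝ)} {S' : Finset V}
    (h : IsSolution f M S S') (hm : Monotone f) (hs : IsSubmodular f) {e : V} {ev : Evaluation V}
    (hev : EvalSpec f M S S' e ev) (hg : ev.Good) {x : V} (hx : Covered f M S S' x) :
    Covered f M (DynSubmod.addSwap S e ev) (insert e S') x := by
  rcases hx with hx | hx | hx
  · exact Or.inl (Finset.mem_insert_of_mem hx)
  · exact Or.inr (Or.inl hx)
  · refine Or.inr (Or.inr (heavySpan_anti M ?_ _ (h.heavySpan_subset_addSwap hm hev hg _ hx)))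
    have := marginal_antitone hm hs x (Finset.subset_insert e S')
    linarith

/-- Candidates that are not kept are covered. -/
theorem IsSolution.covered_of_not_good {S : List (V × ℝ)} {S' : Finset V}
    (h : IsSolution f M S S') {e : V} {ev : Evaluation V}
    (hev : EvalSpec f M S S' e ev) (hg : ¬ ev.Good) : Covered f M S S' e := by
  obtain ⟨wt, x⟩ := ev
  obtain ⟨hw, hx⟩ := hev
  dsimp only at hw hx
  subst hw
  cases x with
  | free => exact absurd trivial hg
  | blocked => exact Or.inr (Or.inl hx)
  | swap y w =>
    obtain ⟨l₁, l₂, rfl, hi, hd⟩ := hx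
    have hg' : ¬ 2 * w < marginal f e S' := hg
    refine Or.inr (Or.inr (heavySpan_anti M ?_ _ (h.mem_heavySpan_of_swap hi hd)))
    linarith

/-- The approximation guarantee. -/
theorem IsSolution.approx {S : List (V × ℝ)} {S' : Finset V} (h : IsSolution f M S S')
    (hm : Monotone f) (hs : IsSubmodular f) {T : Finset V} (hT : M.Indep (T : Set V))
    (hc : ∀ e ∈ T, Covered f M S S' e) : f T ≤ 4 * f (elems S) := by
  classical
  have h1 : f T ≤ f S' + ∑ e ∈ T \ S', marginal f e S' := by
    have := value_union_le hm hs S' (T \ S')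
    rw [Finset.union_sdiff_self_eq_union] at this
    exact (hm Finset.subset_union_right).trans this
  have hnd : S.Nodup := h.nodup.of_map
  -- At each threshold c, the elements of T \ S' with half-gain at least c are independent and
  -- spanned by the elements of S of weight at least c, so the latter are at least as many.
  have h2 : ∑ e ∈ T \ S', marginal f e S' / 2 ≤ ∑ p ∈ S.toFinset, p.2 := by
    refine sum_le_sum_of_card_filter_le _ _ _ _
      (fun p hp => h.weight_nonneg hm (List.mem_toFinset.1 hp)) fun c _ => ?_
    set X := (T \ S').filter fun e => c ≤ marginal f e S' / 2
    set Y := S.toFinset.filter fun p => c ≤ p.2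
    have hXi : M.Indep (X : Set V) := hT.subset fun x hx => by
      have := Finset.mem_coe.1 hx
      simp only [X, Finset.mem_filter, Finset.mem_sdiff] at this
      exact this.1.1
    have hXY : (X : Set V) ⊆ M.closure (Y.image Prod.fst : Finset V) := by
      intro x hx
      have hx' := Finset.mem_coe.1 hx
      simp only [X, Finset.mem_filter, Finset.mem_sdiff] at hx'
      rcases hc x hx'.1.1 with hx1 | hx1 | hx1
      · exact absurd hx1 hx'.1.2
      · exact absurd (hT.subset (by simpa using hx'.1.1)) hx1
      · refine M.closure_subset_closure ?_ (heavySpan_anti M hx'.2 _ hx1)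
        rintro y ⟨w, hy, hw⟩
        simp only [Y, Finset.coe_image, Set.mem_image, Finset.mem_coe, Finset.mem_filter,
          List.mem_toFinset]
        exact ⟨(y, w), ⟨hy, hw⟩, rfl⟩
    have h3 := hXi.encard_le_eRk_of_subset hXY
    rw [M.eRk_closure_eq] at h3
    have h4 := h3.trans (M.eRk_le_encard _)
    rw [Set.encard_coe_eq_coe_finsetCard, Set.encard_coe_eq_coe_finsetCard] at h4
    exact (by exact_mod_cast h4 : X.card ≤ (Y.image Prod.fst).card).trans Finset.card_image_le
  rw [List.sum_toFinset _ hnd, ← Finset.sum_div] at h2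
  have h5 := h.value_le
  have h6 := h.totalWeight_le
  unfold totalWeight at h5 h6
  change _ ≤ (S.map Prod.snd).sum at h2
  linarith

end PartialSolution

/-! ### Correctness of the algorithm -/

section Correctness

variable {V : Type u} [DecidableEq V] {f : Finset V → ℝ} {M : Matroid V}

open OracleProg

/-- The left end stays independent and the right end dependent, so the search must stop at a switch
between consecutive prefixes; monotonicity of the answers is not needed. -/
theorem sat_binarySearch (e : V) (S : List (V × ℝ)) (lo hi : ℕ) (h : lo < hi)
    (hlo : M.Indep (insert e (prefixSet S lo) : Finset V))
    (hhi : ¬ M.Indep (insert e (prefixSet S hi) : Finset V)) :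
    (binarySearch e S lo hi).Sat f M fun i => i < hi ∧
      M.Indep (insert e (prefixSet S i) : Finset V) ∧
      ¬ M.Indep (insert e (prefixSet S (i + 1)) : Finset V) := by
  induction hn : hi - lo using Nat.strong_induction_on generalizing lo hi with
  | _ n ih =>
    rw [binarySearch]
    split_ifs with hlt
    · simp only [Sat]
      by_cases hmid : M.Indep (insert e (prefixSet S ((lo + hi) / 2)) : Finset V)
      · simp only [hmid, decide_true, if_true]
        exact ih _ (by omega) _ hi (by omega) hmid hhi rfl
      · simp only [hmid, decide_false, Bool.false_eq_true, if_false]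
        exact (ih _ (by omega) lo _ (by omega) hlo hmid rfl).mono
          fun i hi => ⟨by omega, hi.2⟩
    · have : hi = lo + 1 := by omega
      subst this
      exact ⟨h, hlo, hhi⟩

theorem sat_findSwap (e : V) (S : List (V × ℝ)) :
    (findSwap e S).Sat f M (ExchangeSpec M S e) := by
  unfold findSwap
  simp only [Sat]
  by_cases h1 : M.Indep (insert e (prefixSet S S.length) : Finset V)
  · simp only [h1, decide_true, if_true, Sat]
    simpa [prefixSet, ExchangeSpec, elems] using h1
  · simp only [h1, decide_false, Bool.false_eq_true, if_false, Sat]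
    by_cases h2 : M.Indep ({e} : Finset V)
    · simp only [h2, decide_true, if_true]
      -- For empty S the two queries so far concern the same set {e} and could not have differed.
      have h3 : 0 < S.length := by
        by_contra h0
        have : S = [] := List.length_eq_zero_iff.1 (by omega)
        subst this
        exact h1 (by simpa [prefixSet] using h2)
      refine (sat_binarySearch e S 0 S.length h3 (by simpa [prefixSet] using h2) h1).bind ?_
      rintro i ⟨hi, hi1, hi2⟩
      rw [List.getElem?_eq_getElem hi]
      refine ⟨S.take i, S.drop (i + 1), ?_, hi1, ?_⟩
      · simp
      · have : prefixSet S (i + 1) = insert S[i].1 (elems (S.take i)) := by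
          unfold prefixSet elems
          rw [List.take_add_one, List.getElem?_eq_getElem hi]
          simp only [Option.toList_some, List.map_append, List.map_cons, List.map_nil,
            List.toFinset_append, List.toFinset_cons, List.toFinset_nil, Finset.union_insert,
            Finset.union_empty]
        rwa [this] at hi2
    · simp only [h2, decide_false, Bool.false_eq_true, if_false, Sat]
      exact h2

theorem sat_evaluateAll (S : List (V × ℝ)) (S' : Finset V) (l : List V) :
    (evaluateAll S S' l).Sat f M fun ev => ∀ e ∈ l, EvalSpec f M S S' e (ev e) := by
  induction l with
  | nil => simp [evaluateAll, Sat]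
  | cons e es ih =>
    simp only [evaluateAll, Sat]
    refine (sat_findSwap e S).bind fun x hx => ih.bind fun ev hev => ?_
    intro y hy
    by_cases hye : y = e
    · subst hye
      rw [Function.update_self]
      exact ⟨rfl, hx⟩
    · rw [Function.update_of_ne hye]
      exact hev y ((List.mem_cons.1 hy).resolve_left hye)

variable (f M) in
/-- The invariant of the candidates `A`, the partial solution `S` and the set `S'`, when `U` is the
set of available elements. -/
structure IsState (U A : Finset V) (S : List (V × ℝ)) (S' : Finset V) : Prop where
  sol : IsSolution f M S S'
  sol_subset : elems S ⊆ U
  cand_subset : A ⊆ U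
  disj : Disjoint A (elems S)
  covered : ∀ x ∈ U, x ∈ A ∨ Covered f M S S' x

theorem IsState.initial (h0 : f ∅ = 0) (hm : Monotone f) (U : Finset V) :
    IsState f M U U [] ∅ :=
  ⟨IsSolution.nil h0 hm, by simp [elems], subset_rfl, by simp [elems], fun _ hx => Or.inl hx⟩

open Classical in
theorem IsState.filter {U A : Finset V} {S : List (V × ℝ)} {S' : Finset V}
    (h : IsState f M U A S S') {ev : V → Evaluation V}
    (hev : ∀ e ∈ A, EvalSpec f M S S' e (ev e)) :
    IsState f M U (A.filter fun e => (ev e).Good) S S' := by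
  refine ⟨h.sol, h.sol_subset, (Finset.filter_subset _ _).trans h.cand_subset,
    h.disj.mono_left (Finset.filter_subset _ _), fun x hx => ?_⟩
  rcases h.covered x hx with hxA | hxc
  · by_cases hg : (ev x).Good
    · exact Or.inl (Finset.mem_filter.2 ⟨hxA, hg⟩)
    · exact Or.inr (h.sol.covered_of_not_good (hev x hxA) hg)
  · exact Or.inr hxc

theorem IsState.pop {U A : Finset V} {S : List (V × ℝ)} {S' : Finset V}
    (h : IsState f M U A S S') (hm : Monotone f) (hs : IsSubmodular f) {e : V} (he : e ∈ A)
    {ev : Evaluation V} (hev : EvalSpec f M S S' e ev) (hg : ev.Good) :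
    IsState f M U (A.erase e) (addSwap S e ev) (insert e S') := by
  have heS : e ∉ elems S := Finset.disjoint_left.1 h.disj he
  have hsub : elems (addSwap S e ev) ⊆ insert e (elems S) := by
    rw [elems_perm (addSwap_perm S e ev), elems_cons]
    exact Finset.insert_subset_insert e (elems_mono (staying_sublist S _).subset)
  refine ⟨h.sol.addSwap hm hs heS hev hg, ?_, (Finset.erase_subset _ _).trans h.cand_subset,
    ?_, fun x hx => ?_⟩
  · exact hsub.trans (Finset.insert_subset (h.cand_subset he) h.sol_subset)
  · refine Finset.disjoint_of_subset_right hsub ?_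
    rw [Finset.disjoint_insert_right]
    exact ⟨Finset.notMem_erase e A, h.disj.mono_left (Finset.erase_subset _ _)⟩
  · rcases h.covered x hx with hxA | hxc
    · by_cases hxe : x = e
      · subst hxe
        exact Or.inr (Or.inl (Finset.mem_insert_self _ _))
      · exact Or.inl (Finset.mem_erase.2 ⟨hxe, hxA⟩)
    · exact Or.inr (h.sol.covered_addSwap hm hs hev hg hxc)

open Classical in
theorem sat_repeatLoop (hm : Monotone f) (hs : IsSubmodular f) {t : ℕ} (ht : 0 < t)
    {U A : Finset V} {S : List (V × ℝ)} {S' : Finset V} (h : IsState f M U A S S') :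
    (repeatLoop t A S S').Sat f M fun r => r.1.card < t ∧ IsState f M U r.1 r.2.1 r.2.2 := by
  induction hn : A.card using Nat.strong_induction_on generalizing A S S' with
  | _ n ih =>
    rw [repeatLoop]
    refine (sat_evaluateAll S S' A.toList).bind fun ev hev => ?_
    simp only [Finset.mem_toList] at hev
    have hF := h.filter hev
    split_ifs with hc
    · intro e
      have heA := Finset.mem_filter.1 e.2
      have hP := hF.pop hm hs e.2 (hev e heA.1) heA.2
      dsimp only
      split_ifs with hlt
      · exact ⟨hlt, hP⟩
      · refine ih _ ?_ hP rfl
        rw [← hn]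
        exact lt_of_lt_of_le (Finset.card_erase_lt_of_mem e.2)
          (Finset.card_le_card (Finset.filter_subset _ _))
    · refine ⟨?_, hF⟩
      by_contra hlt
      exact hc ⟨not_lt.1 hlt, Finset.card_pos.1 (ht.trans_le (not_lt.1 hlt))⟩

/-! ### The invariant of the levels under rebuilding, insertion and deletion -/

variable (f M) in
/-- The invariant of the levels below `m`. -/
def InvBelow (D : DataStructure V) (m : ℕ) : Prop :=
  ∀ l < m, IsState f M D.avail ((D.level l).A ∪ (D.level l).B) (D.level l).S (D.level l).S' ∧
    (D.level l).A.card < 2 ^ (D.L - l) ∧ (D.level l).B.card < 2 ^ (D.L - l)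

variable (f M) in
/-- The invariant of the data structure between operations. -/
def IsValid (D : DataStructure V) : Prop := InvBelow f M D (D.L + 1)

theorem InvBelow.prev (h0 : f ∅ = 0) (hm : Monotone f) {D : DataStructure V} {l : ℕ}
    (h : InvBelow f M D l) :
    IsState f M D.avail ((D.prev l).A ∪ (D.prev l).B) (D.prev l).S (D.prev l).S' := by
  cases l with
  | zero => simpa [DataStructure.prev] using IsState.initial h0 hm D.avail
  | succ l => exact (h l (Nat.lt_succ_self l)).1

/-- A and B of the previous level each have fewer than 2 · 2^(L-l) elements; at level 0 the
candidates are all the available elements. -/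
theorem InvBelow.card_prev_le {D : DataStructure V} {l : ℕ} (h : InvBelow f M D l)
    (hl : l ≤ D.L) (hc : D.avail.card ≤ 2 ^ D.L) :
    ((D.prev l).A ∪ (D.prev l).B).card ≤ 4 * 2 ^ (D.L - l) := by
  cases l with
  | zero =>
    simp only [DataStructure.prev, Finset.empty_union, Nat.sub_zero]
    omega
  | succ l =>
    obtain ⟨-, hA, hB⟩ := h l (Nat.lt_succ_self l)
    have h1 := Finset.card_union_le (D.level l).A (D.level l).B
    have h2 : D.L - l = D.L - (l + 1) + 1 := by omega
    rw [h2, pow_succ] at hA hB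
    simp only [DataStructure.prev]
    omega

theorem IsValid.init (L : ℕ) (h0 : f ∅ = 0) (hm : Monotone f) :
    IsValid f M (DataStructure.init L) := by
  intro l _
  simpa [DataStructure.init, Level.empty] using IsState.initial (M := M) h0 hm ∅

/-- The data structure after the repeat loop of level `l` has ended with the result `r`. -/
def setLevel (D : DataStructure V) (l : ℕ) (r : Finset V × List (V × ℝ) × Finset V) :
    DataStructure V :=
  { D with level := Function.update D.level l ⟨r.1, ∅, r.2.1, r.2.2⟩ }

theorem levelConstruct_eq (D : DataStructure V) (l : ℕ) :
    levelConstruct D l =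
      (repeatLoop (2 ^ (D.L - l)) ((D.prev l).A ∪ (D.prev l).B) (D.prev l).S (D.prev l).S').bind
        fun r => if l < D.L then levelConstruct (setLevel D l r) (l + 1)
          else .ret (setLevel D l r) := by
  rw [levelConstruct]
  rfl

theorem InvBelow.setLevel {D : DataStructure V} {l : ℕ} (h : InvBelow f M D l)
    {r : Finset V × List (V × ℝ) × Finset V} (hr : r.1.card < 2 ^ (D.L - l))
    (hs : IsState f M D.avail r.1 r.2.1 r.2.2) : InvBelow f M (setLevel D l r) (l + 1) := by
  intro j hj
  unfold DynSubmod.setLevel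
  dsimp only
  rcases Nat.lt_succ_iff_lt_or_eq.1 hj with hj | rfl
  · rw [Function.update_of_ne hj.ne]
    exact h j hj
  · rw [Function.update_self]
    exact ⟨by simpa using hs, hr, by simp⟩

theorem sat_levelConstruct (h0 : f ∅ = 0) (hm : Monotone f) (hs : IsSubmodular f)
    (D : DataStructure V) (l : ℕ) (hl : l ≤ D.L) (h : InvBelow f M D l) :
    (levelConstruct D l).Sat f M fun D' =>
      D'.L = D.L ∧ D'.avail = D.avail ∧ IsValid f M D' := by
  induction hn : D.L - l generalizing D l with
  | zero =>
    have : l = D.L := by omega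
    subst this
    rw [levelConstruct_eq]
    refine (sat_repeatLoop hm hs (by positivity) (h.prev h0 hm)).bind fun r hr => ?_
    rw [if_neg (lt_irrefl _)]
    exact ⟨rfl, rfl, h.setLevel hr.1 hr.2⟩
  | succ n ih =>
    rw [levelConstruct_eq]
    refine (sat_repeatLoop hm hs (by positivity) (h.prev h0 hm)).bind fun r hr => ?_
    rw [if_pos (by omega)]
    exact ih (setLevel D l r) (l + 1) (by change l + 1 ≤ D.L; omega) (h.setLevel hr.1 hr.2)
      (by change D.L - (l + 1) = n; omega)

theorem find?_range_cases (p : ℕ → Bool) (n : ℕ) :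
    (∃ l < n, (List.range n).find? p = some l ∧ p l = true ∧ ∀ j < l, p j = false) ∨
      ((List.range n).find? p = none ∧ ∀ j < n, p j = false) := by
  cases h : (List.range n).find? p with
  | none => exact Or.inr ⟨rfl, by simpa using h⟩
  | some l =>
    rw [List.find?_range_eq_some] at h
    exact Or.inl ⟨l, by simpa using h.2.1, rfl, h.1, by simpa using h.2.2⟩

theorem insertElement_cases (e : V) (D : DataStructure V) :
    ∃ l ≤ D.L, insertElement e D = levelConstruct (addToBuffers e D) l ∧
      2 ^ (D.L - l) ≤ (insert e (D.level l).B).card ∧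
      ∀ j < l, (insert e (D.level j).B).card < 2 ^ (D.L - j) := by
  unfold insertElement
  rcases find?_range_cases (fun l => decide (2 ^ (D.L - l) ≤ ((addToBuffers e D).level l).B.card))
    (D.L + 1) with ⟨l, hl, h1, h2, h3⟩ | ⟨h1, h2⟩
  · refine ⟨l, by omega, ?_, of_decide_eq_true h2,
      fun j hj => not_le.1 (of_decide_eq_false (h3 j hj))⟩
    rw [h1]
  · have := h2 D.L (Nat.lt_succ_self _)
    simp [addToBuffers] at this

theorem deleteElement_cases (e : V) (D : DataStructure V) :
    (∃ l ≤ D.L, deleteElement e D = levelConstruct (removeFromSets e D) l ∧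
      e ∈ elems (D.level l).S ∧ ∀ j < l, e ∉ elems (D.level j).S) ∨
    (deleteElement e D = .ret (removeFromSets e D) ∧ ∀ j < D.L + 1, e ∉ elems (D.level j).S) := by
  unfold deleteElement
  rcases find?_range_cases
    (fun l => decide (e ∈ ((removeFromSets e D).level l).S.map Prod.fst)) (D.L + 1) with
    ⟨l, hl, h1, h2, h3⟩ | ⟨h1, h2⟩
  · refine Or.inl ⟨l, by omega, ?_, List.mem_toFinset.2 (of_decide_eq_true h2), fun j hj hmem => ?_⟩
    · rw [h1]
    · exact absurd (List.mem_toFinset.1 hmem) (of_decide_eq_false (h3 j hj))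
  · refine Or.inr ⟨?_, fun j hj hmem => ?_⟩
    · rw [h1]
    · exact absurd (List.mem_toFinset.1 hmem) (of_decide_eq_false (h2 j hj))

theorem IsValid.addToBuffers {D : DataStructure V} (h : IsValid f M D) {e : V}
    (he : e ∉ D.avail) {l : ℕ} (hl : l ≤ D.L)
    (hB : ∀ j < l, (insert e (D.level j).B).card < 2 ^ (D.L - j)) :
    InvBelow f M (addToBuffers e D) l := by
  intro j hj
  obtain ⟨hst, hA, -⟩ := h j (by omega)
  refine ⟨⟨hst.sol, hst.sol_subset.trans (Finset.subset_insert _ _), ?_, ?_, ?_⟩, hA, hB j hj⟩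
  · simp only [DynSubmod.addToBuffers, Finset.union_insert]
    exact Finset.insert_subset_insert e hst.cand_subset
  · simp only [DynSubmod.addToBuffers, Finset.union_insert, Finset.disjoint_insert_left]
    exact ⟨fun hmem => he (hst.sol_subset hmem), hst.disj⟩
  · intro x hx
    simp only [DynSubmod.addToBuffers, Finset.union_insert, Finset.mem_insert] at hx ⊢
    rcases hx with rfl | hx
    · exact Or.inl (Or.inl rfl)
    · exact (hst.covered x hx).imp Or.inr id

/-- Only S must avoid the deleted element. S' may keep it, since S' enters just through f(S') ≤ 2
w(S) and through the coverage of the remaining elements. -/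
theorem IsValid.removeFromSets {D : DataStructure V} (h : IsValid f M D) {e : V} {l : ℕ}
    (hl : l ≤ D.L + 1) (hS : ∀ j < l, e ∉ elems (D.level j).S) :
    InvBelow f M (removeFromSets e D) l := by
  intro j hj
  obtain ⟨hst, hA, hB⟩ := h j (by omega)
  refine ⟨⟨hst.sol, ?_, ?_, ?_, ?_⟩, (Finset.card_erase_le).trans_lt hA,
    (Finset.card_erase_le).trans_lt hB⟩
  · exact fun x hx => Finset.mem_erase.2 ⟨fun hxe => hS j hj (hxe ▸ hx), hst.sol_subset hx⟩
  · simp only [DynSubmod.removeFromSets, ← Finset.erase_union_distrib]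
    exact Finset.erase_subset_erase e hst.cand_subset
  · simp only [DynSubmod.removeFromSets, ← Finset.erase_union_distrib]
    exact hst.disj.mono_left (Finset.erase_subset _ _)
  · intro x hx
    simp only [DynSubmod.removeFromSets, ← Finset.erase_union_distrib, Finset.mem_erase] at hx ⊢
    exact (hst.covered x hx.2).imp (fun h' => ⟨hx.1, h'⟩) id

theorem sat_insertElement (h0 : f ∅ = 0) (hm : Monotone f) (hs : IsSubmodular f)
    {D : DataStructure V} (h : IsValid f M D) {e : V} (he : e ∉ D.avail) :
    (insertElement e D).Sat f M fun D' =>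
      D'.L = D.L ∧ D'.avail = insert e D.avail ∧ IsValid f M D' := by
  obtain ⟨l, hl, heq, -, hB⟩ := insertElement_cases e D
  rw [heq]
  exact sat_levelConstruct h0 hm hs (addToBuffers e D) l hl (h.addToBuffers he hl hB)

theorem sat_deleteElement (h0 : f ∅ = 0) (hm : Monotone f) (hs : IsSubmodular f)
    {D : DataStructure V} (h : IsValid f M D) (e : V) :
    (deleteElement e D).Sat f M fun D' =>
      D'.L = D.L ∧ D'.avail = D.avail.erase e ∧ IsValid f M D' := by
  rcases deleteElement_cases e D with ⟨l, hl, heq, -, hS⟩ | ⟨heq, hS⟩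
  · rw [heq]
    exact sat_levelConstruct h0 hm hs (removeFromSets e D) l hl
      (h.removeFromSets (by omega) hS)
  · rw [heq]
    exact ⟨rfl, rfl, h.removeFromSets le_rfl hS⟩

theorem sat_applyOp (h0 : f ∅ = 0) (hm : Monotone f) (hs : IsSubmodular f)
    {D : DataStructure V} (h : IsValid f M D) {o : Op V} (ho : o.Admissible D.avail) :
    (applyOp o D).Sat f M fun D' =>
      D'.L = D.L ∧ D'.avail = o.apply D.avail ∧ IsValid f M D' := by
  cases o with
  | insertion e => exact sat_insertElement h0 hm hs h ho
  | deletion e => exact sat_deleteElement h0 hm hs h e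

theorem sat_insertList (h0 : f ∅ = 0) (hm : Monotone f) (hs : IsSubmodular f) (l : List V)
    {D : DataStructure V} (h : IsValid f M D) (hl : l.Nodup) (hd : ∀ e ∈ l, e ∉ D.avail) :
    (insertList l D).Sat f M fun D' =>
      D'.L = D.L ∧ D'.avail = l.toFinset ∪ D.avail ∧ IsValid f M D' := by
  induction l generalizing D with
  | nil => exact ⟨rfl, by simp, h⟩
  | cons e es ih =>
    rw [List.nodup_cons] at hl
    refine (sat_insertElement h0 hm hs h (hd e (by simp))).bind ?_
    rintro D' ⟨hL, hav, hv⟩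
    refine (ih hv hl.2 fun x hx => ?_).mono ?_
    · rw [hav, Finset.mem_insert, not_or]
      exact ⟨fun hxe => hl.1 (hxe ▸ hx), hd x (List.mem_cons_of_mem _ hx)⟩
    · rintro D'' ⟨hL', hav', hv'⟩
      refine ⟨hL'.trans hL, ?_, hv'⟩
      rw [hav', hav, List.toFinset_cons, Finset.union_insert, Finset.insert_union]

/-! ### Streams of unknown length -/

variable (f M) in
/-- The invariant of the algorithm between operations. -/
structure AlgInv (s : AlgState V) : Prop where
  valid : IsValid f M s.data
  card_le : s.data.avail.card ≤ s.count
  count_lt : s.count < 2 ^ s.data.L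
  le_count : 2 ^ s.data.L ≤ 2 * s.count + 1

theorem AlgInv.init (h0 : f ∅ = 0) (hm : Monotone f) : AlgInv f M (AlgState.init : AlgState V) :=
  ⟨IsValid.init 0 h0 hm, by simp [AlgState.init, DataStructure.init],
    by simp [AlgState.init, DataStructure.init], by simp [AlgState.init, DataStructure.init]⟩

theorem Op.card_apply_le (o : Op V) (U : Finset V) : (o.apply U).card ≤ U.card + 1 := by
  cases o with
  | insertion e => exact Finset.card_insert_le e U
  | deletion e => exact Finset.card_erase_le.trans (Nat.le_succ _)

theorem sat_rebuild (h0 : f ∅ = 0) (hm : Monotone f) (hs : IsSubmodular f) (U : Finset V)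
    (L : ℕ) : (insertList U.toList (DataStructure.init L)).Sat f M fun D' =>
      D'.L = L ∧ D'.avail = U ∧ IsValid f M D' := by
  refine (sat_insertList h0 hm hs U.toList (IsValid.init L h0 hm) U.nodup_toList
    (by simp [DataStructure.init])).mono ?_
  rintro D' ⟨hL, hav, hv⟩
  exact ⟨hL, by simpa [DataStructure.init] using hav, hv⟩

theorem sat_step (h0 : f ∅ = 0) (hm : Monotone f) (hs : IsSubmodular f) {s : AlgState V}
    (h : AlgInv f M s) {o : Op V} (ho : o.Admissible s.data.avail) :
    (step o s).Sat f M fun s' => AlgInv f M s' ∧ s'.count = s.count + 1 ∧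
      s'.data.avail = o.apply s.data.avail := by
  refine (sat_applyOp h0 hm hs h.valid ho).bind ?_
  rintro D ⟨hL, hav, hv⟩
  have h1 := h.card_le
  have h2 := h.count_lt
  have h3 := h.le_count
  have hcard : D.avail.card ≤ s.count + 1 := by
    have := o.card_apply_le s.data.avail
    rw [hav]
    omega
  rw [← hL] at h2 h3
  split_ifs with hc
  · refine (sat_rebuild h0 hm hs D.avail (D.L + 1)).bind ?_
    rintro D' ⟨hL', hav', hv'⟩
    refine ⟨⟨hv', by rwa [hav'], ?_, ?_⟩, rfl, hav'.trans hav⟩ <;>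
    · simp only [hL', pow_succ]
      omega
  · exact ⟨⟨hv, hcard, by dsimp only; omega, by dsimp only; omega⟩, rfl, hav⟩

/-- A stream of admissible operations that starts when the elements of `U` are available. -/
def IsStreamFrom : Finset V → List (Op V) → Prop
  | _, [] => True
  | U, o :: os => o.Admissible U ∧ IsStreamFrom (o.apply U) os

theorem IsStream.isStreamFrom {ops : List (Op V)} (h : IsStream ops) : IsStreamFrom ∅ ops := by
  suffices H : ∀ post pre : List (Op V), ops = pre ++ post → IsStreamFrom (available pre) post from
    H ops [] rfl
  intro post
  induction post with
  | nil => exact fun _ _ => trivial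
  | cons o os ih =>
    intro pre hpre
    refine ⟨h pre o os hpre, ?_⟩
    have := ih (pre ++ [o]) (by simp [hpre])
    simpa [available] using this

theorem IsStream.take {ops : List (Op V)} (h : IsStream ops) (i : ℕ) : IsStream (ops.take i) := by
  intro pre o post hp
  refine h pre o (post ++ ops.drop i) ?_
  conv_lhs => rw [← List.take_append_drop i ops, hp]
  simp

theorem sat_process (h0 : f ∅ = 0) (hm : Monotone f) (hs : IsSubmodular f) (ops : List (Op V))
    {s : AlgState V} (h : AlgInv f M s) (ho : IsStreamFrom s.data.avail ops) :
    (process ops s).Sat f M fun s' => AlgInv f M s' ∧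
      s'.data.avail = ops.foldl (fun U o => o.apply U) s.data.avail := by
  induction ops generalizing s with
  | nil => exact ⟨h, rfl⟩
  | cons o os ih =>
    refine (sat_step h0 hm hs h ho.1).bind ?_
    rintro s' ⟨hs', -, hav⟩
    have := ih hs' (hav ▸ ho.2)
    rwa [hav] at this

/-- Level L has threshold 2^0 = 1, so its candidate set and buffer are empty and every available
element is covered. -/
theorem AlgInv.approx (hm : Monotone f) (hs : IsSubmodular f) {s : AlgState V}
    (h : AlgInv f M s) : s.solution ⊆ s.data.avail ∧ M.Indep (s.solution : Set V) ∧
      ∀ T : Finset V, T ⊆ s.data.avail → M.Indep (T : Set V) → f T ≤ 4 * f s.solution := by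
  obtain ⟨hst, hA, hB⟩ := h.valid s.data.L (Nat.lt_succ_self _)
  simp only [Nat.sub_self, pow_zero, Nat.lt_one_iff, Finset.card_eq_zero] at hA hB
  refine ⟨hst.sol_subset, hst.sol.indep, fun T hT hTi => hst.sol.approx hm hs hTi fun e he => ?_⟩
  refine (hst.covered e (hT he)).resolve_left ?_
  simp [hA, hB]

/-- The solution is feasible and a 4-approximation for all outcomes of the random choices. -/
theorem solution_spec (h0 : f ∅ = 0) (hm : Monotone f) (hs : IsSubmodular f) {ops : List (Op V)}
    (ho : IsStream ops) {r : AlgState V × ℕ} (hr : r ∈ (outcome f M ops).support) :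
    r.1.solution ⊆ available ops ∧ M.Indep (r.1.solution : Set V) ∧
      ∀ T : Finset V, T ⊆ available ops → M.Indep (T : Set V) → f T ≤ 4 * f r.1.solution := by
  obtain ⟨hi, hav⟩ := (sat_process h0 hm hs ops (AlgInv.init h0 hm) ho.isStreamFrom).of_mem_support
    hr
  have := hi.approx hm hs
  rwa [hav] at this

end Correctness

/-! ### The number of oracle calls -/

/-- A uniformly random one of at least t elements has mean charge at most a when the charges sum to
at most t a. -/
theorem sum_div_card_le {V : Type u} {A : Finset V} {t a Y : ℕ} (ht : t ≤ A.card)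
    {g : V → ℕ} (hg : ∑ x ∈ A, g x ≤ t * a) {F : A → ℝ≥0∞} (hF : ∀ x, F x ≤ (Y + g x : ℕ)) :
    (∑ x : A, F x) / (A.card : ℝ≥0∞) ≤ (Y + a : ℕ) := by
  have h1 : ∑ x : A, F x ≤ ((Y + a : ℕ) : ℝ≥0∞) * A.card := by
    refine (Finset.sum_le_sum fun x _ => hF x).trans ?_
    rw [← Nat.cast_sum]
    norm_cast
    rw [Finset.sum_coe_sort A fun x => Y + g x, Finset.sum_add_distrib, Finset.sum_const,
      smul_eq_mul]
    nlinarith [Nat.mul_le_mul_right a ht]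
  exact ENNReal.div_le_of_le_mul h1

/-! ### Charges that anticipate the next deletion of an element -/

section Charge

variable {V : Type u}

open Classical in
/-- The charge of `e`, when the stream continues with the given operations: `W`, decreased by `w` for
every operation up to the next deletion of `e`. -/
noncomputable def charge (w : ℕ) : List (Op V) → ℕ → V → ℕ
  | [], _, _ => 0
  | o :: os, W, e => if o = .deletion e then W - w else charge w os (W - w) e

theorem charge_le (w : ℕ) (ops : List (Op V)) (W : ℕ) (e : V) : charge w ops W e ≤ W := by
  induction ops generalizing W with
  | nil => exact Nat.zero_le _
  | cons o os ih =>
    rw [charge]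
    split_ifs
    · exact Nat.sub_le _ _
    · exact (ih _).trans (Nat.sub_le _ _)

theorem charge_sub (w : ℕ) (ops : List (Op V)) (W : ℕ) (e : V) :
    charge w ops W e ≤ charge w ops (W - w) e + w := by
  induction ops generalizing W with
  | nil => exact Nat.zero_le _
  | cons o os ih =>
    rw [charge, charge]
    split_ifs
    · omega
    · exact ih _

/-- The discount counts the operations still to come, so each operation that passes returns at most
w, until the charge is back to W up to w right before the deletion. -/
theorem charge_le_cons (w : ℕ) (o : Op V) (os : List (Op V)) (W : ℕ) (e : V) :
    charge w os W e ≤ charge w (o :: os) W e + w := by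
  rw [charge]
  split_ifs
  · have := charge_le w os W e
    omega
  · exact charge_sub w os W e

theorem le_charge_deletion (w : ℕ) (os : List (Op V)) (W : ℕ) (e : V) :
    W ≤ charge w (.deletion e :: os) W e + w := by
  rw [charge, if_pos rfl]
  omega

end Charge

/-! ### Cost of evaluations and of one repeat loop -/

section Cost

variable {V : Type u} [DecidableEq V] {f : Finset V → ℝ} {M : Matroid V}

open OracleProg

theorem ecost_binarySearch (e : V) (S : List (V × ℝ)) (lo hi : ℕ) (c : ℝ≥0∞) :
    (binarySearch e S lo hi).ecost f M (fun _ => c) ≤ Nat.clog 2 (hi - lo) + c := by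
  induction hn : hi - lo using Nat.strong_induction_on generalizing lo hi with
  | _ n ih =>
    rw [binarySearch]
    split_ifs with hlt
    · have hclog : Nat.clog 2 n = Nat.clog 2 ((n + 1) / 2) + 1 :=
        Nat.clog_of_two_le (by norm_num) (by omega)
      have key : ∀ m, m ≤ (n + 1) / 2 →
          (1 : ℝ≥0∞) + ((Nat.clog 2 m : ℕ) + c) ≤ (Nat.clog 2 n : ℕ) + c := by
        intro m hm
        have h1 : 1 + Nat.clog 2 m ≤ Nat.clog 2 n := by
          have := Nat.clog_mono_right 2 hm
          omega
        rw [← add_assoc]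
        gcongr
        exact_mod_cast h1
      simp only [ecost]
      split_ifs
      · exact (add_le_add_right (ih _ (by omega) _ hi rfl) 1).trans (key _ (by omega))
      · exact (add_le_add_right (ih _ (by omega) lo _ rfl) 1).trans (key _ (by omega))
    · exact le_add_self

theorem ecost_findSwap (e : V) (S : List (V × ℝ)) (c : ℝ≥0∞) :
    (findSwap e S).ecost f M (fun _ => c) ≤ (2 + Nat.clog 2 S.length : ℕ) + c := by
  have key : (1 : ℝ≥0∞) + (1 + ((Nat.clog 2 S.length : ℕ) + c))
      = (2 + Nat.clog 2 S.length : ℕ) + c := by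
    push_cast
    rw [← one_add_one_eq_two]
    ring
  rw [← key]
  unfold findSwap
  simp only [ecost]
  refine add_le_add_right ?_ 1
  split_ifs with h1
  · exact le_add_self.trans (add_le_add_right le_add_self 1)
  · simp only [ecost]
    refine add_le_add_right ?_ 1
    split_ifs with h2
    · rw [ecost_bind]
      refine le_trans (le_of_eq ?_) (ecost_binarySearch (f := f) (M := M) e S 0 S.length c)
      congr 1
      funext i
      cases S[i]? <;> rfl
    · exact le_add_self

/-- Four fixed calls per candidate: two values and the tests of S + e and {e}. The rest is the
binary search. -/
theorem ecost_evaluateAll (S : List (V × ℝ)) (S' : Finset V) (l : List V) (c : ℝ≥0∞) :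
    (evaluateAll S S' l).ecost f M (fun _ => c) ≤
      (l.length * (4 + Nat.clog 2 S.length) : ℕ) + c := by
  induction l with
  | nil => simp [evaluateAll, ecost]
  | cons e es ih =>
    simp only [evaluateAll, ecost, ecost_bind]
    have h1 := (ecost_findSwap (f := f) (M := M) e S
      ((es.length * (4 + Nat.clog 2 S.length) : ℕ) + c))
    have h2 : (findSwap e S).ecost f M (fun _ => (evaluateAll S S' es).ecost f M fun _ => c) ≤
        (findSwap e S).ecost f M fun _ => (es.length * (4 + Nat.clog 2 S.length) : ℕ) + c :=
      (sat_findSwap e S).ecost_mono fun _ _ => ih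
    refine (add_le_add_right (add_le_add_right (h2.trans h1) 1) 1).trans (le_of_eq ?_)
    rw [List.length_cons, Nat.succ_mul]
    push_cast
    ring

variable (f M) in
/-- A function `lev` of the weights that increases by at least `1` with every swap, where the sum
over a partial solution is at most `K`. -/
structure IsRank (lev : ℝ → ℕ) (K : ℕ) : Prop where
  pos : ∀ w, 1 ≤ lev w
  lt : ∀ x T y U, 2 * marginal f x T < marginal f y U → lev (marginal f x T) < lev (marginal f y U)
  sum_le : ∀ S S', IsPartial f M S S' → (S.map fun p => lev p.2).sum ≤ K

/-- A free insertion contributes at least 1, and a swap replaces a class by a strictly larger one.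
-/
theorem IsRank.addSwap {lev : ℝ → ℕ} {K : ℕ} (h : IsRank f M lev K)
    {S : List (V × ℝ)} {S' : Finset V} (hS : IsPartial f M S S') {e : V} {ev : Evaluation V}
    (hev : EvalSpec f M S S' e ev) (hg : ev.Good) :
    (S.map fun p => lev p.2).sum + 1 ≤ ((addSwap S e ev).map fun p => lev p.2).sum := by
  obtain ⟨wt, x⟩ := ev
  obtain ⟨hw, hx⟩ := hev
  dsimp only at hw hx
  subst hw
  rw [((addSwap_perm S e _).map fun p : V × ℝ => lev p.2).sum_eq, List.map_cons, List.sum_cons]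
  cases x with
  | free =>
    have := h.pos (marginal f e S')
    simp only [staying]
    omega
  | blocked => exact hg.elim
  | swap y w =>
    obtain ⟨l₁, l₂, rfl, -, -⟩ := hx
    obtain ⟨z, T, hz⟩ := hS.weight (y, w) (by simp)
    dsimp only at hz
    subst hz
    have h1 := h.lt z T e S' hg
    rw [staying_swap hS.nodup, (List.perm_middle.map fun p : V × ℝ => lev p.2).sum_eq,
      List.map_cons, List.sum_cons]
    dsimp only
    omega

open Classical in
/-- The cost of a repeat loop, together with the total of the charges `g` of the new elements of
the partial solution. -/
theorem ecost_repeatLoop (hm : Monotone f) (hs : IsSubmodular f) {lev : ℝ → ℕ} {K q : ℕ}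
    (hr : IsRank f M lev K)
    (hq : ∀ S S', IsPartial f M S S' → 4 + Nat.clog 2 S.length ≤ q) {t a : ℕ} {g : V → ℕ}
    (hg : ∀ A : Finset V, ∑ x ∈ A, g x ≤ t * a) (S₀ : Finset V)
    {U A : Finset V} {S : List (V × ℝ)} {S' : Finset V} (h : IsState f M U A S S') :
    (repeatLoop t A S S').ecost f M (fun r => ((∑ x ∈ elems r.2.1 \ S₀, g x : ℕ) : ℝ≥0∞)) ≤
      ((∑ x ∈ elems S \ S₀, g x) + (K - (S.map fun p => lev p.2).sum) * a +
        (K - (S.map fun p => lev p.2).sum + 1) * (A.card * q) : ℕ) := by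
  induction hn : A.card using Nat.strong_induction_on generalizing A S S' with
  | _ n ih =>
    subst hn
    rw [repeatLoop]
    -- d bounds the additions still possible. X keeps d · a for charges and d further evaluation
    -- rounds; the summand |A| · q missing from X pays for the current round.
    set d := K - (S.map fun p => lev p.2).sum with hd
    set X := (∑ x ∈ elems S \ S₀, g x) + d * a + d * (A.card * q) with hX
    refine ecost_bind_le (fun _ => (X : ℝ≥0∞)) (sat_evaluateAll S S' A.toList) ?_ ?_
    · refine (ecost_evaluateAll S S' _ _).trans ?_
      rw [Finset.length_toList]
      norm_cast
      have := Nat.mul_le_mul_left A.card (hq S S' h.sol.toIsPartial)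
      rw [hX, add_mul]
      omega
    · intro ev hev
      simp only [Finset.mem_toList] at hev
      have hF := h.filter hev
      split_ifs with hc
      · simp only [ecost]
        have hd1 : 1 ≤ d := by
          obtain ⟨e, he⟩ := hc.2
          have heA := Finset.mem_filter.1 he
          have hP := hF.pop hm hs he (hev e heA.1) heA.2
          have h1 := hr.addSwap h.sol.toIsPartial (hev e heA.1) heA.2
          have h2 := hr.sum_le _ _ hP.sol.toIsPartial
          omega
        -- One of the d units of a pays the mean charge of the random pick.
        refine (sum_div_card_le (Y := (∑ x ∈ elems S \ S₀, g x) + (d - 1) * a + d * (A.card * q))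
          hc.1 (hg _) fun e => ?_).trans ?_
        · have heA := Finset.mem_filter.1 e.2
          have hP := hF.pop hm hs e.2 (hev e heA.1) heA.2
          have h1 := hr.addSwap h.sol.toIsPartial (hev e heA.1) heA.2
          have hsum : ∑ x ∈ elems (addSwap S e (ev e)) \ S₀, g x ≤
              (∑ x ∈ elems S \ S₀, g x) + g e := by
            refine (Finset.sum_le_sum_of_subset (t := insert (e : V) (elems S \ S₀)) ?_).trans ?_
            · rw [elems_perm (addSwap_perm S e _), elems_cons]
              intro x
              simp only [Finset.mem_sdiff, Finset.mem_insert]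
              rintro ⟨rfl | hx, hx0⟩
              · exact Or.inl rfl
              · exact Or.inr ⟨elems_mono (staying_sublist S _).subset hx, hx0⟩
            · by_cases hmem : (e : V) ∈ elems S \ S₀
              · rw [Finset.insert_eq_of_mem hmem]
                exact Nat.le_add_right _ _
              · rw [Finset.sum_insert hmem, add_comm]
          split_ifs with hlt
          · simp only [ecost]
            norm_cast
            omega
          · have hcard : ((A.filter fun e => (ev e).Good).erase e).card < A.card :=
              lt_of_lt_of_le (Finset.card_erase_lt_of_mem e.2)
                (Finset.card_le_card (Finset.filter_subset _ _))
            refine (ih _ hcard hP rfl).trans ?_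
            norm_cast
            have h3 : K - ((addSwap S e (ev e)).map fun p => lev p.2).sum ≤ d - 1 := by omega
            have h4 := Nat.mul_le_mul_right a h3
            have h5 := Nat.mul_le_mul
              (show K - ((addSwap S e (ev e)).map fun p => lev p.2).sum + 1 ≤ d by omega)
              (Nat.mul_le_mul_right q hcard.le)
            omega
        · norm_cast
          obtain ⟨d', hd'⟩ : ∃ d', d = d' + 1 := ⟨d - 1, by omega⟩
          rw [hX, hd', Nat.add_sub_cancel, Nat.succ_mul d' a]
          omega
      · simp only [ecost]
        norm_cast
        omega

/-! ### The potential -/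

/-- The j-th coming operation is the next deletion of at most one element, whose charge is then W -
j w; the sum of this progression, cut off at 0, is at most W²/w. -/
theorem mul_sum_charge_le (w : ℕ) (ops : List (Op V)) (W : ℕ) (A : Finset V) :
    w * ∑ e ∈ A, charge w ops W e ≤ W * W := by
  classical
  induction ops generalizing W with
  | nil => simp [charge]
  | cons o os ih =>
    have h1 : ∑ e ∈ A, charge w (o :: os) W e ≤ (W - w) + ∑ e ∈ A, charge w os (W - w) e := by
      have h2 : ∀ e ∈ A, charge w (o :: os) W e ≤
          (if o = .deletion e then W - w else 0) + charge w os (W - w) e := by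
        intro e _
        rw [charge]
        split_ifs <;> omega
      refine (Finset.sum_le_sum h2).trans ?_
      rw [Finset.sum_add_distrib]
      refine Nat.add_le_add_right ?_ _
      cases o with
      | insertion x => simp
      | deletion x =>
        simp only [Op.deletion.injEq, Finset.sum_ite_eq]
        split_ifs <;> omega
    have h3 := ih (W - w)
    rcases le_total W w with hW | hW
    · rw [Nat.sub_eq_zero_of_le hW] at h1 h3
      calc _ ≤ w * (0 + ∑ e ∈ A, charge w os 0 e) := Nat.mul_le_mul_left w h1
        _ ≤ 0 := by rw [zero_add]; simpa using h3
        _ ≤ _ := Nat.zero_le _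
    · obtain ⟨z, rfl⟩ := Nat.exists_eq_add_of_le hW
      rw [Nat.add_sub_cancel_left] at h1 h3
      nlinarith [Nat.mul_le_mul_left w h1]

/-- The potential of level `l`, when the stream continues with the given operations. -/
noncomputable def levelPotential (u w : ℕ) (ops : List (Op V)) (D : DataStructure V) (l : ℕ) : ℕ :=
  u * (D.level l).B.card +
    (elems (D.level l).S \ elems (D.prev l).S).sup (charge w ops (u * 2 ^ (D.L - l)))

/-- The potential of the data structure, when the stream continues with the given operations. -/
noncomputable def potential (u w : ℕ) (ops : List (Op V)) (D : DataStructure V) : ℕ :=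
  ∑ l ∈ Finset.range (D.L + 1), levelPotential u w ops D l

theorem potential_init (u w : ℕ) (ops : List (Op V)) (L : ℕ) :
    potential u w ops (DataStructure.init L) = 0 := by
  simp [potential, levelPotential, DataStructure.init, Level.empty, elems]

/-- A maximum of charges grows by at most w per operation, however many elements the level has
added; a sum would lose this. -/
theorem levelPotential_le {u w : ℕ} {o : Op V} {os : List (Op V)} {D D' : DataStructure V} {b : ℕ}
    (hL : D'.L = D.L) (hS : ∀ l, (D'.level l).S = (D.level l).S) (l : ℕ)
    (hB : (D'.level l).B.card ≤ (D.level l).B.card + b) :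
    levelPotential u w os D' l ≤ levelPotential u w (o :: os) D l + (u * b + w) := by
  have hp : (D'.prev l).S = (D.prev l).S := by
    cases l with
    | zero => rfl
    | succ l => exact hS l
  unfold levelPotential
  rw [hL, hS, hp]
  have h1 := Nat.mul_le_mul_left u hB
  rw [mul_add] at h1
  have h2 : (elems (D.level l).S \ elems (D.prev l).S).sup (charge w os (u * 2 ^ (D.L - l))) ≤
      (elems (D.level l).S \ elems (D.prev l).S).sup (charge w (o :: os) (u * 2 ^ (D.L - l)))
        + w := by
    refine Finset.sup_le fun e he => (charge_le_cons w o os _ e).trans ?_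
    exact Nat.add_le_add_right (Finset.le_sup (f := charge w (o :: os) _) he) w
  omega

theorem sum_range_add_le {g : ℕ → ℕ} {l L c : ℕ} (hl : l ≤ L) (hc : c ≤ g l) :
    ∑ j ∈ Finset.range l, g j + c ≤ ∑ j ∈ Finset.range (L + 1), g j := by
  calc _ ≤ ∑ j ∈ Finset.range (l + 1), g j := by
        rw [Finset.sum_range_succ]
        omega
    _ ≤ _ := Finset.sum_le_sum_of_subset (Finset.range_subset_range.2 (by omega))

theorem levelPotential_setLevel_of_lt (u w : ℕ) (ops : List (Op V)) (D : DataStructure V)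
    {j l : ℕ} (h : j < l) (r : Finset V × List (V × ℝ) × Finset V) :
    levelPotential u w ops (setLevel D l r) j = levelPotential u w ops D j := by
  have h1 : ∀ i < l, (setLevel D l r).level i = D.level i := fun i hi =>
    Function.update_of_ne hi.ne _ _
  unfold levelPotential
  rw [h1 j h]
  cases j with
  | zero => rfl
  | succ j =>
    simp only [DataStructure.prev]
    rw [h1 j (by omega)]
    rfl

theorem levelPotential_setLevel_self_le (u w : ℕ) (ops : List (Op V)) (D : DataStructure V)
    (l : ℕ) (r : Finset V × List (V × ℝ) × Finset V) :
    levelPotential u w ops (setLevel D l r) l ≤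
      ∑ x ∈ elems r.2.1 \ elems (D.prev l).S, charge w ops (u * 2 ^ (D.L - l)) x := by
  have h1 : (setLevel D l r).level l = ⟨r.1, ∅, r.2.1, r.2.2⟩ := Function.update_self _ _ _
  have h2 : ((setLevel D l r).prev l).S = (D.prev l).S := by
    cases l with
    | zero => rfl
    | succ j => exact congrArg Level.S (Function.update_of_ne (Nat.lt_succ_self j).ne _ _)
  unfold levelPotential
  rw [h1, h2]
  simp only [Finset.card_empty, mul_zero, zero_add]
  exact Finset.sup_le fun x hx => Finset.single_le_sum (fun _ _ => Nat.zero_le _) hx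

/-- The potential per unit of the size of a level. -/
def unitPotential (K q : ℕ) : ℕ := 32 * K * q

/-- The loss of potential per operation at a level. -/
def unitDecay (K q : ℕ) : ℕ := 4 * K * unitPotential K q

/-- With W = u t and w = 4Ku, the bound W²/w is u t²/(4K) = 8 q t². -/
theorem sum_charge_le {K q : ℕ} (hK : 1 ≤ K) (hq1 : 1 ≤ q) (ops : List (Op V)) (t : ℕ)
    (A : Finset V) :
    ∑ x ∈ A, charge (unitDecay K q) ops (unitPotential K q * t) x ≤ t * (8 * q * t) := by
  have h1 := mul_sum_charge_le (unitDecay K q) ops (unitPotential K q * t) A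
  have hpos : 0 < unitDecay K q := by
    unfold unitDecay unitPotential
    positivity
  refine Nat.le_of_mul_le_mul_left (h1.trans (le_of_eq ?_)) hpos
  unfold unitDecay unitPotential
  ring

end Cost

/-! ### Amortized analysis of operations and of the whole stream -/

section TotalCost

variable {V : Type u} [DecidableEq V] {f : Finset V → ℝ} {M : Matroid V} {lev : ℝ → ℕ} {K q : ℕ}

open OracleProg

variable (f M) in
/-- The assumptions on the instance: a partial solution is changed at most `K` times, and each
evaluation of a candidate takes at most `q` oracle calls. -/
structure CostBounds (lev : ℝ → ℕ) (K q : ℕ) : Prop where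
  empty : f ∅ = 0
  mono : Monotone f
  submod : IsSubmodular f
  rank : IsRank f M lev K
  eval : ∀ S S', IsPartial f M S S' → 4 + Nat.clog 2 S.length ≤ q
  one_le : 1 ≤ K

theorem CostBounds.one_le_eval (hb : CostBounds f M lev K q) : 1 ≤ q := by
  have := hb.eval [] ∅ (IsPartial.nil hb.empty hb.mono)
  omega

/-- The reconstruction of the levels from `l` on is paid for by the potential of level `l`. -/
theorem CostBounds.ecost_levelConstruct (hb : CostBounds f M lev K q) (ops : List (Op V))
    (D : DataStructure V) (l : ℕ) (hl : l ≤ D.L) (h : InvBelow f M D l)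
    (hc : ((D.prev l).A ∪ (D.prev l).B).card ≤ 4 * 2 ^ (D.L - l)) :
    (levelConstruct D l).ecost f M
        (fun D' => (potential (unitPotential K q) (unitDecay K q) ops D' : ℝ≥0∞)) ≤
      ((∑ j ∈ Finset.range l, levelPotential (unitPotential K q) (unitDecay K q) ops D j) +
        unitPotential K q * 2 ^ (D.L - l) : ℕ) := by
  have hq1 := hb.one_le_eval
  have hK := hb.one_le
  induction hn : D.L - l using Nat.strong_induction_on generalizing D l with
  | _ n ih =>
    rw [levelConstruct_eq, hn]
    set u := unitPotential K q with hu
    set w := unitDecay K q with hw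
    set P := ∑ j ∈ Finset.range l, levelPotential u w ops D j with hP
    set g := charge w ops (u * 2 ^ n) with hg
    have hst := h.prev hb.empty hb.mono
    have hsum : ∀ r, ∑ j ∈ Finset.range (l + 1), levelPotential u w ops (setLevel D l r) j ≤
        P + ∑ x ∈ elems r.2.1 \ elems (D.prev l).S, g x := by
      intro r
      rw [Finset.sum_range_succ]
      refine add_le_add (le_of_eq (Finset.sum_congr rfl fun j hj =>
        levelPotential_setLevel_of_lt u w ops D (Finset.mem_range.1 hj) r)) ?_
      rw [hg, ← hn]
      exact levelPotential_setLevel_self_le u w ops D l r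
    refine ecost_bind_le
      (fun r => ((∑ x ∈ elems r.2.1 \ elems (D.prev l).S, g x : ℕ) : ℝ≥0∞) +
        (P + 16 * K * q * 2 ^ n : ℕ))
      (sat_repeatLoop hb.mono hb.submod (by positivity) hst) ?_ ?_
    · rw [ecost_add_const]
      refine (add_le_add_left (ecost_repeatLoop hb.mono hb.submod hb.rank hb.eval
        (fun A => sum_charge_le hK hq1 ops (2 ^ n) A) _ hst) _).trans ?_
      rw [sdiff_self, Finset.bot_eq_empty, Finset.sum_empty, zero_add]
      norm_cast
      rw [hn] at hc
      have h1 := Nat.mul_le_mul_right (8 * q * 2 ^ n)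
        (Nat.sub_le K ((D.prev l).S.map fun p => lev p.2).sum)
      have h2 := Nat.mul_le_mul
        (show K - ((D.prev l).S.map fun p => lev p.2).sum + 1 ≤ 2 * K by omega)
        (Nat.mul_le_mul_right q hc)
      -- The budget u t, with t = 2^n: K picks of mean charge 8qt, at most K + 1 ≤ 2K evaluation
      -- rounds on at most 4t candidates, and 16Kqt = u t/2, exactly the budget of the next level.
      have h3 : u * 2 ^ n = K * (8 * q * 2 ^ n) + 2 * K * (4 * 2 ^ n * q) + 16 * K * q * 2 ^ n := by
        rw [hu, unitPotential]
        ring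
      omega
    · rintro r ⟨hr1, hr2⟩
      have h1 := hsum r
      split_ifs with hlt
      · obtain ⟨m, rfl⟩ : ∃ m, n = m + 1 := ⟨n - 1, by omega⟩
        have hL : (setLevel D l r).L - (l + 1) = m := by
          change D.L - (l + 1) = m
          omega
        refine (ih m (by omega) (setLevel D l r) (l + 1) hlt (h.setLevel (hn.symm ▸ hr1) hr2) ?_
          hL).trans ?_
        · rw [hL]
          simp only [DataStructure.prev, setLevel, Function.update_self, Finset.union_empty]
          rw [pow_succ] at hr1
          omega
        · norm_cast
          have h2 : u * 2 ^ m = 16 * K * q * 2 ^ (m + 1) := by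
            rw [hu, unitPotential]
            ring
          omega
      · have hL : l = D.L := by omega
        simp only [ecost]
        norm_cast
        have h2 : potential u w ops (setLevel D l r) =
            ∑ j ∈ Finset.range (l + 1), levelPotential u w ops (setLevel D l r) j := by
          unfold potential
          rw [hL]
          rfl
        omega

/-- The amortized cost of an operation per level. -/
def levelCharge (K q : ℕ) : ℕ := unitPotential K q + unitDecay K q

theorem potential_le {K q b : ℕ} {o : Op V} {os : List (Op V)} {D D' : DataStructure V}
    (hb : b ≤ 1) (hL : D'.L = D.L) (hS : ∀ l, (D'.level l).S = (D.level l).S)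
    (hB : ∀ l, (D'.level l).B.card ≤ (D.level l).B.card + b) :
    potential (unitPotential K q) (unitDecay K q) os D' ≤
      potential (unitPotential K q) (unitDecay K q) (o :: os) D + (D.L + 1) * levelCharge K q := by
  unfold potential
  rw [hL]
  have h1 : unitPotential K q * b + unitDecay K q ≤ levelCharge K q :=
    Nat.add_le_add_right ((Nat.mul_le_mul_left _ hb).trans (mul_one _).le) _
  refine (Finset.sum_le_sum fun l _ => (levelPotential_le (o := o) hL hS l (hB l)).trans
    (Nat.add_le_add_left h1 _)).trans (le_of_eq ?_)
  rw [Finset.sum_add_distrib, Finset.sum_const, Finset.card_range, smul_eq_mul]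

/-- The buffer that triggers the rebuild has at least 2^(L-l) elements, so its share of the
potential is the full budget. -/
theorem CostBounds.ecost_insertElement (hb : CostBounds f M lev K q) (os : List (Op V))
    {D : DataStructure V} (h : IsValid f M D) {e : V} (he : e ∉ D.avail)
    (hc : D.avail.card + 1 ≤ 2 ^ D.L) :
    (insertElement e D).ecost f M
        (fun D' => (potential (unitPotential K q) (unitDecay K q) os D' : ℝ≥0∞)) ≤
      (potential (unitPotential K q) (unitDecay K q) (.insertion e :: os) D +
        (D.L + 1) * levelCharge K q : ℕ) := by
  obtain ⟨l, hl, heq, hbig, hB⟩ := insertElement_cases e D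
  rw [heq]
  have hI := h.addToBuffers he hl hB
  refine (hb.ecost_levelConstruct os (addToBuffers e D) l hl hI (hI.card_prev_le hl
    ((Finset.card_insert_le _ _).trans hc))).trans ?_
  rw [Nat.cast_le]
  refine le_trans ?_ (potential_le (D' := addToBuffers e D) (o := .insertion e) le_rfl rfl
    (fun _ => rfl) fun l => Finset.card_insert_le _ _)
  refine sum_range_add_le hl ?_
  exact (Nat.mul_le_mul_left _ hbig).trans (Nat.le_add_right _ _)

/-- By minimality of l the element e was added at level l, so its charge counts there. As e is
deleted right now, this charge is the full budget up to w, and the amortized cost supplies the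
missing w. -/
theorem CostBounds.ecost_deleteElement (hb : CostBounds f M lev K q) (os : List (Op V))
    {D : DataStructure V} (h : IsValid f M D) (e : V) (hc : D.avail.card ≤ 2 ^ D.L) :
    (deleteElement e D).ecost f M
        (fun D' => (potential (unitPotential K q) (unitDecay K q) os D' : ℝ≥0∞)) ≤
      (potential (unitPotential K q) (unitDecay K q) (.deletion e :: os) D +
        (D.L + 1) * levelCharge K q : ℕ) := by
  have hB : ∀ l, ((removeFromSets e D).level l).B.card ≤ (D.level l).B.card + 0 :=
    fun l => Finset.card_erase_le
  rcases deleteElement_cases e D with ⟨l, hl, heq, hmem, hS⟩ | ⟨heq, hS⟩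
  · rw [heq]
    have hI := h.removeFromSets (by omega) hS
    refine (hb.ecost_levelConstruct os (removeFromSets e D) l hl hI (hI.card_prev_le hl
      (Finset.card_erase_le.trans hc))).trans ?_
    rw [Nat.cast_le]
    set u := unitPotential K q with hu
    set w := unitDecay K q with hw
    have h1 : ∀ j, levelPotential u w os (removeFromSets e D) j ≤
        levelPotential u w (.deletion e :: os) D j + levelCharge K q := fun j =>
      (levelPotential_le (D := D) (D' := removeFromSets e D) (b := 0) rfl (fun _ => rfl) j
        (hB j)).trans
        (Nat.add_le_add_left
          (show u * 0 + w ≤ levelCharge K q by rw [mul_zero, zero_add]; exact Nat.le_add_left _ _) _)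
    have h2 : u * 2 ^ (D.L - l) ≤
        levelPotential u w (.deletion e :: os) D l + levelCharge K q := by
      have h3 : e ∉ elems (D.prev l).S := by
        cases l with
        | zero => simp [DataStructure.prev, elems]
        | succ l => exact hS l (Nat.lt_succ_self l)
      have h4 := le_charge_deletion w os (u * 2 ^ (D.L - l)) e
      have h5 := Finset.le_sup (f := charge w (.deletion e :: os) (u * 2 ^ (D.L - l)))
        (Finset.mem_sdiff.2 ⟨hmem, h3⟩)
      unfold levelPotential levelCharge
      omega
    refine (Nat.add_le_add_right (Finset.sum_le_sum fun j _ => h1 j) _).trans ?_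
    refine (sum_range_add_le (g := fun j =>
      levelPotential u w (.deletion e :: os) D j + levelCharge K q) hl h2).trans (le_of_eq ?_)
    rw [Finset.sum_add_distrib, Finset.sum_const, Finset.card_range, smul_eq_mul]
    rfl
  · rw [heq]
    simp only [ecost]
    rw [Nat.cast_le]
    exact potential_le (Nat.zero_le 1) rfl (fun _ => rfl) hB

theorem CostBounds.ecost_applyOp (hb : CostBounds f M lev K q) (o : Op V) (os : List (Op V))
    {D : DataStructure V} (h : IsValid f M D) (ho : o.Admissible D.avail)
    (hc : D.avail.card + 1 ≤ 2 ^ D.L) :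
    (applyOp o D).ecost f M
        (fun D' => (potential (unitPotential K q) (unitDecay K q) os D' : ℝ≥0∞)) ≤
      (potential (unitPotential K q) (unitDecay K q) (o :: os) D +
        (D.L + 1) * levelCharge K q : ℕ) := by
  cases o with
  | insertion e => exact hb.ecost_insertElement os h ho hc
  | deletion e => exact hb.ecost_deleteElement os h e (by omega)

/-- The reinsertions are treated as operations preceding the rest of the stream, so that the charges
see a consistent future. -/
theorem CostBounds.ecost_insertList (hb : CostBounds f M lev K q) (l : List V) (os : List (Op V))
    {D : DataStructure V} (h : IsValid f M D) (hl : l.Nodup) (hd : ∀ e ∈ l, e ∉ D.avail)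
    (hc : D.avail.card + l.length ≤ 2 ^ D.L) :
    (insertList l D).ecost f M
        (fun D' => (potential (unitPotential K q) (unitDecay K q) os D' : ℝ≥0∞)) ≤
      (potential (unitPotential K q) (unitDecay K q) (l.map .insertion ++ os) D +
        l.length * ((D.L + 1) * levelCharge K q) : ℕ) := by
  induction l generalizing D with
  | nil => simp [insertList, ecost]
  | cons e es ih =>
    rw [List.nodup_cons] at hl
    rw [List.length_cons] at hc
    have he : e ∉ D.avail := hd e (by simp)
    refine ecost_bind_le (fun D' => (potential (unitPotential K q) (unitDecay K q)
        (es.map .insertion ++ os) D' : ℝ≥0∞) +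
        (es.length * ((D.L + 1) * levelCharge K q) : ℕ))
      (sat_insertElement hb.empty hb.mono hb.submod h he) ?_ ?_
    · rw [ecost_add_const]
      refine (add_le_add_left (hb.ecost_insertElement _ h he (by omega)) _).trans ?_
      rw [← Nat.cast_add, Nat.cast_le, List.length_cons, Nat.succ_mul es.length, List.map_cons,
        List.cons_append]
      omega
    · rintro D' ⟨hL, hav, hv⟩
      refine (ih hv hl.2 (fun x hx => ?_) ?_).trans ?_
      · rw [hav, Finset.mem_insert, not_or]
        exact ⟨fun hxe => hl.1 (hxe ▸ hx), hd x (List.mem_cons_of_mem _ hx)⟩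
      · rw [hav, hL, Finset.card_insert_of_notMem he]
        omega
      · rw [hL]
        push_cast
        exact le_rfl

/-- The number of operations whose amortized cost is held in reserve for the next time that the data
structure is built anew. -/
def reserve (s : AlgState V) : ℕ := 2 * s.count + 1 - 2 ^ s.data.L

/-- Of three units per operation, one pays for the operation and two go into the reserve. When count
+ 1 = 2^L the old reserve equals count; with the two new units it pays for at most count + 1
reinsertions and leaves the reserve 1 of the new structure. -/
theorem CostBounds.ecost_step (hb : CostBounds f M lev K q) (o : Op V) (os : List (Op V))
    {s : AlgState V} (h : AlgInv f M s) (ho : o.Admissible s.data.avail) {N : ℕ}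
    (hN : s.count + 1 ≤ N) :
    (step o s).ecost f M
        (fun s' => (potential (unitPotential K q) (unitDecay K q) os s'.data : ℝ≥0∞) +
          (reserve s' * ((Nat.log 2 N + 2) * levelCharge K q) : ℕ)) ≤
      (potential (unitPotential K q) (unitDecay K q) (o :: os) s.data +
        (reserve s + 3) * ((Nat.log 2 N + 2) * levelCharge K q) : ℕ) := by
  have hlt := h.count_lt
  have hle := h.le_count
  have hcard := h.card_le
  have hL1 : s.data.L ≤ Nat.log 2 N + 1 := by
    rcases Nat.eq_zero_or_pos s.data.L with h0 | h0
    · omega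
    · obtain ⟨m, hm⟩ : ∃ m, s.data.L = m + 1 := ⟨s.data.L - 1, by omega⟩
      rw [hm, pow_succ] at hle
      have := Nat.le_log_of_pow_le (b := 2) (x := m) (y := N) (by norm_num) (by omega)
      omega
  set c := (Nat.log 2 N + 2) * levelCharge K q
  have hcL : (s.data.L + 1) * levelCharge K q ≤ c := Nat.mul_le_mul_right _ (by omega)
  refine ecost_bind_le (fun D => (potential (unitPotential K q) (unitDecay K q) os D : ℝ≥0∞) +
      ((reserve s + 2) * c : ℕ))
    (sat_applyOp hb.empty hb.mono hb.submod h.valid ho) ?_ ?_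
  · rw [ecost_add_const]
    refine (add_le_add_left (hb.ecost_applyOp o os h.valid ho (by omega)) _).trans ?_
    norm_cast
    have : (reserve s + 3) * c = (reserve s + 2) * c + c := by ring
    omega
  · rintro D ⟨hL, hav, hv⟩
    have hDc : D.avail.card ≤ s.count + 1 := by
      have := o.card_apply_le s.data.avail
      rw [hav]
      omega
    split_ifs with hdouble
    · rw [hL] at hdouble ⊢
      -- Here 2^L ≤ N, so the rebuilt structure, with L + 2 levels, also has at most log N + 2 of
      -- them.
      have hlog := Nat.le_log_of_pow_le (b := 2) (by norm_num) (hdouble ▸ hN)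
      refine ecost_bind_le
        (fun D' => (potential (unitPotential K q) (unitDecay K q) os D' : ℝ≥0∞) + (c : ℕ))
        (sat_rebuild hb.empty hb.mono hb.submod D.avail (s.data.L + 1)) ?_ ?_
      · rw [ecost_add_const]
        refine (add_le_add_left (hb.ecost_insertList D.avail.toList os
          (IsValid.init _ hb.empty hb.mono) D.avail.nodup_toList
          (by simp [DataStructure.init]) ?_) _).trans ?_
        · simp only [DataStructure.init, Finset.card_empty, Finset.length_toList, pow_succ]
          omega
        · rw [potential_init, Finset.length_toList]
          norm_cast
          have h1 : D.avail.card * ((s.data.L + 1 + 1) * levelCharge K q) ≤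
              (reserve s + 1) * c := by
            refine Nat.mul_le_mul ?_ (Nat.mul_le_mul_right _ (by omega))
            unfold reserve
            omega
          have h2 : (reserve s + 2) * c = (reserve s + 1) * c + c := by ring
          change 0 + D.avail.card * ((s.data.L + 1 + 1) * levelCharge K q) + c ≤ _
          omega
      · rintro D' ⟨hL', -, -⟩
        simp only [ecost]
        refine add_le_add le_rfl ?_
        norm_cast
        have h1 : reserve (⟨s.count + 1, D'⟩ : AlgState V) ≤ 1 := by
          simp only [reserve, hL', pow_succ]
          omega
        exact (Nat.mul_le_mul_right c h1).trans (one_mul c).le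
    · simp only [ecost]
      refine add_le_add le_rfl ?_
      norm_cast
      refine Nat.mul_le_mul_right c ?_
      simp only [reserve, hL]
      omega

theorem CostBounds.ecost_process (hb : CostBounds f M lev K q) (ops : List (Op V))
    {s : AlgState V} (h : AlgInv f M s) (ho : IsStreamFrom s.data.avail ops) {N : ℕ}
    (hN : s.count + ops.length ≤ N) :
    (process ops s).ecost f M (fun _ => 0) ≤
      (potential (unitPotential K q) (unitDecay K q) ops s.data +
        (reserve s + 3 * ops.length) * ((Nat.log 2 N + 2) * levelCharge K q) : ℕ) := by
  induction ops generalizing s with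
  | nil => simp [process, ecost]
  | cons o os ih =>
    rw [List.length_cons] at hN
    refine ecost_bind_le (fun s' => ((potential (unitPotential K q) (unitDecay K q) os s'.data :
        ℝ≥0∞) + (reserve s' * ((Nat.log 2 N + 2) * levelCharge K q) : ℕ)) +
        (3 * os.length * ((Nat.log 2 N + 2) * levelCharge K q) : ℕ))
      (sat_step hb.empty hb.mono hb.submod h ho.1) ?_ ?_
    · rw [ecost_add_const]
      refine (add_le_add_left (hb.ecost_step o os h ho.1 (by omega)) _).trans (le_of_eq ?_)
      rw [List.length_cons]
      push_cast
      ring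
    · rintro s' ⟨hs', hcount, hav⟩
      refine (ih hs' (hav ▸ ho.2) (by omega)).trans (le_of_eq ?_)
      push_cast
      ring

theorem CostBounds.expectedCalls_le (hb : CostBounds f M lev K q) {ops : List (Op V)}
    (ho : IsStream ops) : expectedCalls (outcome f M ops) ≤
      (ops.length * (3 * ((Nat.log 2 ops.length + 2) * levelCharge K q)) : ℕ) := by
  unfold outcome
  rw [expectedCalls_run]
  refine (hb.ecost_process ops (AlgInv.init hb.empty hb.mono) ho.isStreamFrom
    (N := ops.length) (by simp [AlgState.init])).trans (le_of_eq ?_)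
  change ((potential _ _ ops (DataStructure.init 0) + (0 + 3 * ops.length) * _ : ℕ) : ℝ≥0∞) = _
  rw [potential_init]
  congr 1
  ring

end TotalCost

/-! ### The parameters in terms of the rank and of the spread -/

section Parameters

variable {V : Type u} [DecidableEq V] {f : Finset V → ℝ} {M : Matroid V}

/-- The smallest nonzero marginal gain. -/
theorem exists_marginal_bounds [Fintype V] (h0 : f ∅ = 0) (hm : Monotone f)
    (hs : IsSubmodular f) : ∃ δ : ℝ, 0 < δ ∧
      (∀ x T, marginal f x T ≠ 0 → δ ≤ marginal f x T) ∧
      ∀ x T, marginal f x T / δ ≤ spread f := by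
  set R := {r : ℝ | ∃ (T : Finset V) (x : V), marginal f x T ≠ 0 ∧ r = marginal f x T} with hR
  rcases R.eq_empty_or_nonempty with hE | hE
  · have hz : ∀ x T, marginal f x T = 0 := fun x T => by
      by_contra hne
      exact Set.eq_empty_iff_forall_notMem.1 hE _ ⟨T, x, hne, rfl⟩
    -- Without nonzero gains any positive δ serves: `sInf ∅ = 0` and division by zero make the
    -- spread 0.
    refine ⟨1, one_pos, fun x T h => absurd (hz x T) h, fun x T => ?_⟩
    rw [hz, spread, ← hR, hE]
    simp
  · have hfin : R.Finite := by
      refine (Set.finite_range fun p : V × Finset V => marginal f p.1 p.2).subset ?_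
      rintro r ⟨T, x, -, rfl⟩
      exact ⟨(x, T), rfl⟩
    have hbdd : BddBelow R := hfin.bddBelow
    have hpos : 0 < sInf R := by
      obtain ⟨T, x, hne, hx⟩ := hE.csInf_mem hfin
      rw [hx]
      exact (marginal_nonneg hm x T).lt_of_ne' hne
    refine ⟨sInf R, hpos, fun x T h => csInf_le hbdd ⟨T, x, h, rfl⟩, fun x T => ?_⟩
    refine div_le_div_of_nonneg_right ?_ hpos.le
    have h1 : marginal f x T ≤ f {x} := by
      have := marginal_antitone hm hs x (Finset.empty_subset T)
      simpa [marginal, h0] using this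
    exact h1.trans (le_ciSup (f := fun x : V => f {x}) (Set.finite_range _).bddAbove x)

/-- The number of the class of weights, when weights differ by a factor two at most within a
class. -/
noncomputable def weightClass (δ w : ℝ) : ℕ :=
  if w ≤ 0 then 1 else 2 + Nat.log 2 ⌊w / δ⌋₊

/-- Nonzero gains are at least δ, so ⌊w/δ⌋ ≥ 1 and doubling w raises its logarithm by at least 1.
Zero weights have class 1 of their own, below all positive ones. At most k elements of class at most
2 + log Δ give K. -/
theorem isRank_weightClass (hm : Monotone f) {δ Δ : ℝ} (hδ : 0 < δ)
    (hmin : ∀ x T, marginal f x T ≠ 0 → δ ≤ marginal f x T)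
    (hmax : ∀ x T, marginal f x T / δ ≤ Δ) {k : ℕ} (hk : M.eRank = k) :
    IsRank f M (weightClass δ) (k * (2 + Nat.log 2 ⌊Δ⌋₊)) where
  pos w := by
    unfold weightClass
    split_ifs <;> omega
  lt x T y U hlt := by
    have hx := marginal_nonneg hm x T
    unfold weightClass
    rw [if_neg (by linarith : ¬ marginal f y U ≤ 0)]
    split_ifs with h
    · omega
    · have h1 : 1 ≤ ⌊marginal f x T / δ⌋₊ := by
        rw [Nat.one_le_floor_iff, le_div_iff₀ hδ, one_mul]
        exact hmin x T fun h0 => h h0.le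
      have h2 : ⌊marginal f x T / δ⌋₊ * 2 ≤ ⌊marginal f y U / δ⌋₊ := by
        refine Nat.le_floor ?_
        push_cast
        have := Nat.floor_le (div_nonneg hx hδ.le)
        have h3 : 2 * (marginal f x T / δ) ≤ marginal f y U / δ := by
          rw [← mul_div_assoc]
          exact div_le_div_of_nonneg_right hlt.le hδ.le
        linarith
      have h3 := Nat.log_mono_right (b := 2) h2
      rw [Nat.log_mul_base (by norm_num) (by omega)] at h3
      omega
  sum_le S S' h := by
    have h1 : ∀ n ∈ S.map fun p => weightClass δ p.2, n ≤ 2 + Nat.log 2 ⌊Δ⌋₊ := by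
      intro n hn
      obtain ⟨p, hp, rfl⟩ := List.mem_map.1 hn
      obtain ⟨x, T, hw⟩ := h.weight p hp
      unfold weightClass
      split_ifs
      · omega
      · have := Nat.log_mono_right (b := 2) (Nat.floor_le_floor (hmax x T))
        rw [hw]
        omega
    have h2 := List.sum_le_card_nsmul _ _ h1
    rw [List.length_map, smul_eq_mul] at h2
    exact h2.trans (Nat.mul_le_mul_right _ (h.length_le hk))

theorem one_le_logCut (x : ℝ) : 1 ≤ logCut x := by
  unfold logCut
  rw [Real.le_logb_iff_rpow_le (by norm_num) (by positivity)]
  simp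

theorem natLog_le_logCut (n : ℕ) {x : ℝ} (h : (n : ℝ) ≤ max 2 x) : (Nat.log 2 n : ℝ) ≤ logCut x := by
  rcases Nat.eq_zero_or_pos n with rfl | hn
  · simpa using zero_le_one.trans (one_le_logCut x)
  · unfold logCut
    refine (Real.natLog_le_logb n 2).trans ?_
    exact Real.logb_le_logb_of_le (by norm_num) (by exact_mod_cast hn) h

theorem natLog_floor_le_logCut (x : ℝ) : (Nat.log 2 ⌊x⌋₊ : ℝ) ≤ logCut x := by
  refine natLog_le_logCut _ ?_
  rcases le_total 0 x with hx | hx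
  · exact (Nat.floor_le hx).trans (le_max_right _ _)
  · simp [Nat.floor_of_nonpos hx]

theorem natClog_le_logCut (k : ℕ) : (Nat.clog 2 k : ℝ) ≤ logCut k + 1 := by
  have h1 : Nat.clog 2 k ≤ Nat.log 2 k + 1 := by
    rw [Nat.clog_le_iff_le_pow (by norm_num)]
    exact (Nat.lt_pow_succ_log_self (by norm_num) k).le
  have h2 := natLog_le_logCut k (x := k) (le_max_right _ _)
  have h3 : (Nat.clog 2 k : ℝ) ≤ Nat.log 2 k + 1 := by exact_mod_cast h1
  linarith

theorem levelCharge_bound {k n c d : ℕ} (hk : 1 ≤ k) {x y z : ℝ} (hc : (c : ℝ) ≤ x + 1)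
    (hd : (d : ℝ) ≤ y) (hn : (n : ℝ) ≤ z) (hx : 1 ≤ x) (hy : 1 ≤ y) (hz : 1 ≤ z) :
    ((3 * ((n + 2) * levelCharge (k * (2 + d)) (4 + c)) : ℕ) : ℝ) ≤
      100000 * ((k : ℝ) ^ 2 * x * y ^ 2 * z ^ 2) := by
  have hk' : (1 : ℝ) ≤ k := by exact_mod_cast hk
  set K : ℝ := k * (2 + d) with hKdef
  have hK1 : 1 ≤ K := by
    have : (0 : ℝ) ≤ d := Nat.cast_nonneg d
    nlinarith
  have hK : K ≤ 3 * (k * y) := by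
    rw [hKdef]
    nlinarith
  have hq : (4 : ℝ) + c ≤ 6 * x := by linarith
  have hKK : K * (1 + 4 * K) ≤ 45 * (k * y) ^ 2 := by
    have := mul_le_mul hK hK (by linarith) (by positivity)
    nlinarith
  -- The number of levels contributes only one factor z; the square is the weaker form in which the
  -- bound is stated.
  have hzz : z ≤ z ^ 2 := by nlinarith
  have hnz : (n : ℝ) + 2 ≤ 3 * z ^ 2 := by linarith
  have hcast : ((3 * ((n + 2) * levelCharge (k * (2 + d)) (4 + c)) : ℕ) : ℝ) =
      96 * ((n + 2) * ((K * (1 + 4 * K)) * (4 + c))) := by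
    simp only [levelCharge, unitDecay, unitPotential, hKdef]
    push_cast
    ring
  rw [hcast]
  have hpos : (0 : ℝ) ≤ (k * y) ^ 2 * x * z ^ 2 := by positivity
  calc _ ≤ 96 * ((3 * z ^ 2) * ((45 * (k * y) ^ 2) * (6 * x))) := by gcongr
    _ = 77760 * ((k * y) ^ 2 * x * z ^ 2) := by ring
    _ ≤ 100000 * ((k * y) ^ 2 * x * z ^ 2) := by linarith
    _ = _ := by ring

end Parameters

end DynSubmod

/-! ### The main theorem -/

open scoped ENNReal in
theorem mainTheorem1 :
    ∃ C : ℝ, 0 < C ∧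
      ∀ (V : Type*) [Fintype V] [DecidableEq V] (f : Finset V → ℝ) (M : Matroid V) (k : ℕ)
        (ops : List (DynSubmod.Op V)),
        f ∅ = 0 → Monotone f → DynSubmod.IsSubmodular f → M.eRank = k → DynSubmod.IsStream ops →
        (∀ i ≤ ops.length, ∀ r ∈ (DynSubmod.outcome f M (ops.take i)).support,
          r.1.solution ⊆ DynSubmod.available (ops.take i) ∧
          M.Indep (r.1.solution : Set V) ∧
          ∀ T : Finset V, T ⊆ DynSubmod.available (ops.take i) → M.Indep (T : Set V) →
            f T ≤ 4 * f r.1.solution) ∧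
        (1 ≤ k →
          DynSubmod.expectedCalls (DynSubmod.outcome f M ops) ≤
            (ops.length : ℝ≥0∞) *
              ENNReal.ofReal (C * ((k : ℝ) ^ 2 * DynSubmod.logCut k *
                DynSubmod.logCut (DynSubmod.spread f) ^ 2 *
                DynSubmod.logCut ops.length ^ 2))) := by
  refine ⟨100000, by norm_num, ?_⟩
  intro V _ _ f M k ops h0 hm hs hk ho
  refine ⟨fun i _ r hr => DynSubmod.solution_spec h0 hm hs (ho.take i) hr, fun hk1 => ?_⟩
  obtain ⟨δ, hδ, hmin, hmax⟩ := DynSubmod.exists_marginal_bounds h0 hm hs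
  have hb : DynSubmod.CostBounds f M (DynSubmod.weightClass δ)
      (k * (2 + Nat.log 2 ⌊DynSubmod.spread f⌋₊)) (4 + Nat.clog 2 k) :=
    ⟨h0, hm, hs, DynSubmod.isRank_weightClass hm hδ hmin hmax hk,
      fun S S' h => Nat.add_le_add_left (Nat.clog_mono_right 2 (h.length_le hk)) 4,
      Nat.mul_pos hk1 (by omega)⟩
  refine (hb.expectedCalls_le ho).trans ?_
  rw [Nat.cast_mul]
  refine mul_le_mul_right ?_ _
  rw [← ENNReal.ofReal_natCast]
  refine ENNReal.ofReal_le_ofReal ?_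
  have hkl := DynSubmod.natClog_le_logCut k
  have hΔ := DynSubmod.natLog_floor_le_logCut (DynSubmod.spread f)
  have hn := DynSubmod.natLog_le_logCut ops.length (x := ops.length) (le_max_right _ _)
  have hkl1 := DynSubmod.one_le_logCut k
  have hΔ1 := DynSubmod.one_le_logCut (DynSubmod.spread f)
  have hn1 := DynSubmod.one_le_logCut ops.length
  exact DynSubmod.levelCharge_bound hk1 hkl hΔ hn hkl1 hΔ1 hn1
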